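/- Let $G$ be a finite abelian group with character group $\widehat G$ (trivial character $\iota$, unit $e$). Let $\mathcal B$ be the set of bonds of the square lattice $\mathbb Z^2$, oriented to the right or upwards, with the Hilbert space $\mathbb C^{|G|}$ with orthonormal basis $\{|g\rangle\}_{g\in G}$ at each bond. For finite $\Lambda\subset\mathcal B$ let $\mathcal A_\Lambda\cong M_{|G|^{|\Lambda|}}(\mathbb C)$ be the algebra of observables on $\Lambda$, let $\mathcal A_{loc}=\bigcup_\Lambda\mathcal A_\Lambda$, and let the quasi-local algebra $\mathcal A$ be the norm completion of $\mathcal A_{loc}$. A state is a positive linear functional $\omega$ on $\mathcal A$ with $\omega(I)=1$. For a vertex $v$ and $g\in G$ let $A_v^g$ be the operator on the four bonds at $v$ (the star of $v$) that maps a basis vector $|a\rangle$ to the one obtained by multiplying $a$ by $g$ on the bonds leaving $v$ and by $g^{-1}$ on the bonds arriving at $v$. For a face $f$ and $h\in G$ let $B_f^h$ be the projector, on the four bonds around $f$ (the plaquette of $f$), onto the span of the basis vectors with clockwise monodromy $h$ around $f$. Put $A_v=\frac1{|G|}\sum_{g\in G}A_v^g$ and $B_f=B_f^e$. Let $\Lambda_L$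 be the set of bonds in $[-L,L]^2$, let $\mathcal V_L$ and $\mathcal F_L$ be the sets of stars and of plaquettes contained in $\Lambda_L$, and let $$H_L=\sum_{v\in\mathcal V_L}(I-A_v)+\sum_{f\in\mathcal F_L}(I-B_f).$$ Let $\delta$ be the closure of the derivation $A\mapsto\lim_{L\to\infty}[H_L,A]$ on $\mathcal A_{loc}$, and let $K$ be the set of (infinite volume) ground states, that is, of states $\omega$ with $\omega(A^*\delta(A))\ge 0$ for all $A\in\operatorname{dom}(\delta)$. Let $K^0$ be the set of frustration-free ground states, that is, of $\omega\in K$ with $\omega(I-A_v)=\omega(I-B_f)=0$ for all vertices $v$ and faces $f$. For $\chi\in\widehat G$ and $c\in G$ put $D_v^\chi=\frac1{|G|}\sum_{g\in G}\overline{\chi(g)}A_v^g$ and $D_f^c=B_f^c$, and $$D_L^{\chi}=\sum_{\prod_v\chi_v=\chi}\ \prod_{v\in\mathcal V_L}D_v^{\chi_v},\qquad D_L^{c}=\sum_{\prod_f c_f=c}\ \prod_{f\in\mathcal F_L}D_f^{c_f},\qquad D_L^{\chi,c}=D_L^\chi D_L^c,$$ where the sums are over the families $(\chi_v)_{v\in\mathcal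 V_L}$ in $\widehat G$ and $(c_f)_{f\in\mathcal F_L}$ in $G$ with the indicated product. Let $K^{\chi,c}$ be the set of all states $\varphi$ for which there is an $\omega\in K$ such that $\lim_{L\to\infty}\omega(D_L^{\chi,c})$ exists and is positive, and $$\varphi=\mathrm{w}^*\text{-}\lim_{L\to\infty}\frac{\omega(\,\cdot\,D_L^{\chi,c})}{\omega(D_L^{\chi,c})}.$$ **Theorem.** For all $\chi\in\widehat G$ and $c\in G$, the closure of $K^{\chi,c}$ in the weak* topology is $$\overline{K^{\chi,c}}^{\,w}=\operatorname{Conv}\left(K^0\cup K^{\chi,e}\cup K^{\iota,c}\cup K^{\chi,c}\right),$$ where $\operatorname{Conv}$ denotes the convex hull. -/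

import Mathlib

open Filter Topology
open scoped ComplexOrder

namespace KitaevQD

/-! ### The bonds of the square lattice, stars and plaquettes -/

/-- A vertex of the square lattice. -/
abbrev Vertex : Type := ℤ × ℤ

/-- A face (unit square) of the square lattice, labelled by its lower-left corner. -/
abbrev Face : Type := ℤ × ℤ

/-- An oriented bond of the square lattice: its starting vertex, and whether it points
right (`false`) or up (`true`). -/
abbrev Bond : Type := Vertex × Bool

/-- The starting vertex of a bond. -/
def Bond.source (e : Bond) : Vertex := e.1

/-- The end vertex of a bond. -/
def Bond.target (e : Bond) : Vertex :=
  if e.2 then (e.1.1, e.1.2 + 1) else (e.1.1 + 1, e.1.2)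

/-- The star at `v`: the four bonds that share the vertex `v`. -/
def starAt (v : Vertex) : Finset Bond :=
  {(v, false), (v, true), ((v.1 - 1, v.2), false), ((v.1, v.2 - 1), true)}

/-- The plaquette of the face `f`: its bottom, left, top and right bonds. -/
def plaquette (f : Face) : Finset Bond :=
  {(f, false), (f, true), ((f.1, f.2 + 1), false), ((f.1 + 1, f.2), true)}

/-- The square of all vertices in `[-L, L]²`. -/
noncomputable def square (L : ℕ) : Finset Vertex :=
  Finset.Icc (-(L : ℤ)) (L : ℤ) ×ˢ Finset.Icc (-(L : ℤ)) (L : ℤ)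

/-- `Λ_L`: all bonds with both ends in `[-L, L]²`. -/
noncomputable def box (L : ℕ) : Finset Bond :=
  (square L ×ˢ (Finset.univ : Finset Bool)).filter fun e => Bond.target e ∈ square L

/-- The (vertices of the) stars contained in `Λ_L`. -/
noncomputable def verts (L : ℕ) : Finset Vertex := (square L).filter fun v => starAt v ⊆ box L

/-- The faces whose plaquette is contained in `Λ_L`. -/
noncomputable def faces (L : ℕ) : Finset Face := (square L).filter fun f => plaquette f ⊆ box L

theorem mem_star_iff (v : Vertex) (e : Bond) :
    e ∈ starAt v ↔ e.source = v ∨ e.target = v := by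
  obtain ⟨⟨x, y⟩, b⟩ := e
  obtain ⟨a, c⟩ := v
  cases b <;> simp [starAt, Bond.source, Bond.target] <;> omega

/-- No star is lost by only looking at vertices of `square L`. -/
theorem mem_verts_iff (L : ℕ) (v : Vertex) : v ∈ verts L ↔ starAt v ⊆ box L := by
  refine ⟨fun h => (Finset.mem_filter.1 h).2, fun h => Finset.mem_filter.2 ⟨?_, h⟩⟩
  have : ((v, false) : Bond) ∈ box L := h (by simp [starAt])
  exact (Finset.mem_product.1 (Finset.mem_filter.1 this).1).1

/-- No plaquette is lost by only looking at lower-left corners in `square L`. -/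
theorem mem_faces_iff (L : ℕ) (f : Face) : f ∈ faces L ↔ plaquette f ⊆ box L := by
  refine ⟨fun h => (Finset.mem_filter.1 h).2, fun h => Finset.mem_filter.2 ⟨?_, h⟩⟩
  have : ((f, false) : Bond) ∈ box L := h (by simp [plaquette])
  exact (Finset.mem_product.1 (Finset.mem_filter.1 this).1).1

/-! ### The local algebras and the quasi-local algebra

Every local matrix algebra `M_{|G|^|Λ|}(ℂ)` is realised on one Hilbert space, with orthonormal
basis indexed by the configurations `c : Bond → G`: a matrix `M` indexed by the configurations
of `Λ` acts as `M ⊗ 1`, that is, on the coordinates in `Λ` only. This gives compatible injective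
(hence isometric) `*`-homomorphisms, so that the norm closure of the union of the images is the
quasi-local algebra (the inductive limit of the local matrix algebras, whose C*-norm is unique).
-/

/-- The Hilbert space `ℓ²(G^{bonds})`. -/
abbrev Hilb (G : Type*) : Type _ := lp (fun _ : Bond → G => ℂ) 2

section Embedding

variable {G : Type*}

/-- The restriction of a configuration to `Λ`. -/
def res (Λ : Finset Bond) (c : Bond → G) : Λ → G := fun e => c e

/-- The configuration that agrees with `x` on `Λ` and with `c` outside of `Λ`. -/
def patch (Λ : Finset Bond) (c : Bond → G) (x : Λ → G) : Bond → G :=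
  fun e => if h : e ∈ Λ then x ⟨e, h⟩ else c e

@[simp] theorem res_patch (Λ : Finset Bond) (c : Bond → G) (x : Λ → G) :
    res Λ (patch Λ c x) = x := by
  funext e; simp [res, patch]

@[simp] theorem patch_patch (Λ : Finset Bond) (c : Bond → G) (x y : Λ → G) :
    patch Λ (patch Λ c x) y = patch Λ c y := by
  funext e; by_cases h : e ∈ Λ <;> simp [patch, h]

@[simp] theorem patch_res (Λ : Finset Bond) (c : Bond → G) :
    patch Λ c (res Λ c) = c := by
  funext e; by_cases h : e ∈ Λ <;> simp [patch, res, h]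

theorem continuous_coord (c : Bond → G) : Continuous fun ψ : Hilb G => (ψ c : ℂ) :=
  (lp.lipschitzWith_one_eval 2 c).continuous

variable [CommGroup G] [Fintype G]

theorem memℓp_comp_patch (Λ : Finset Bond) (ψ : Hilb G) (x : Λ → G) :
    Memℓp (fun c : Bond → G => (ψ (patch Λ c x) : ℂ)) 2 := by
  classical
  let t : (Λ → G) → (Bond → G) := fun a => patch Λ 1 (a⁻¹ * x)
  have ht : ∀ a : Λ → G, Memℓp (fun c : Bond → G => (‖(ψ (c * t a) : ℂ)‖ : ℝ)) 2 := by
    intro a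
    have h := (lp.memℓp ψ).summable (by norm_num)
    refine memℓp_gen ?_
    simpa [Function.comp_def] using (Equiv.mulRight (t a)).summable_iff.2 h
  refine Memℓp.mono (Memℓp.finsetSum (Finset.univ : Finset (Λ → G)) fun a _ => ht a) ?_
  intro c
  have hc : patch Λ c x = c * t (res Λ c) := by
    funext e; by_cases h : e ∈ Λ <;> simp [patch, res, t, h]
  have h1 := Finset.single_le_sum (f := fun a => (‖(ψ (c * t a) : ℂ)‖ : ℝ))
    (fun a _ => norm_nonneg _) (Finset.mem_univ (res Λ c))
  simpa [hc, Finset.sum_apply] using h1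

theorem memℓp_local (Λ : Finset Bond) (M : Matrix (Λ → G) (Λ → G) ℂ) (ψ : Hilb G) :
    Memℓp (fun c : Bond → G => ∑ x : Λ → G, M (res Λ c) x * ψ (patch Λ c x)) 2 := by
  classical
  refine Memℓp.mono (g := fun c => ∑ x : Λ → G,
    (∑ a : Λ → G, ‖M a x‖) * ‖(ψ (patch Λ c x) : ℂ)‖) ?_ ?_
  · have := Memℓp.finsetSum (p := 2) (E := fun _ : Bond → G => ℝ) (Finset.univ : Finset (Λ → G))
      (f := fun x c => (∑ a : Λ → G, ‖M a x‖) * ‖(ψ (patch Λ c x) : ℂ)‖)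
      (fun x _ => Memℓp.const_mul (memℓp_norm_iff.2 (memℓp_comp_patch Λ ψ x)) _)
    convert this using 1
  · intro c
    refine (norm_sum_le _ _).trans (Finset.sum_le_sum fun x _ => ?_)
    rw [norm_mul]
    gcongr
    exact Finset.single_le_sum (f := fun a => ‖M a x‖) (fun a _ => norm_nonneg _)
      (Finset.mem_univ (res Λ c))

/-- The linear map `M ⊗ 1`. -/
noncomputable def localLin (Λ : Finset Bond) (M : Matrix (Λ → G) (Λ → G) ℂ) :
    Hilb G →ₗ[ℂ] Hilb G where
  toFun ψ := ⟨fun c => ∑ x : Λ → G, M (res Λ c) x * ψ (patch Λ c x), memℓp_local Λ M ψ⟩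
  map_add' ψ φ := by
    apply lp.ext; funext c
    change ∑ x : Λ → G, M (res Λ c) x * (ψ (patch Λ c x) + φ (patch Λ c x)) =
      ∑ x : Λ → G, M (res Λ c) x * ψ (patch Λ c x) + ∑ x : Λ → G, M (res Λ c) x * φ (patch Λ c x)
    simp only [mul_add, Finset.sum_add_distrib]
  map_smul' k ψ := by
    apply lp.ext; funext c
    simp [Finset.mul_sum, mul_left_comm]

theorem localLin_apply (Λ : Finset Bond) (M : Matrix (Λ → G) (Λ → G) ℂ) (ψ : Hilb G)
    (c : Bond → G) :
    localLin Λ M ψ c = ∑ x : Λ → G, M (res Λ c) x * ψ (patch Λ c x) := rfl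

theorem continuous_localLin (Λ : Finset Bond) (M : Matrix (Λ → G) (Λ → G) ℂ) :
    Continuous (localLin Λ M) := by
  refine LinearMap.continuous_of_seq_closed_graph _ fun u x y hu hy => ?_
  apply lp.ext; funext c
  have h1 : Tendsto (fun n => (localLin Λ M (u n) c : ℂ)) atTop (𝓝 (y c)) :=
    ((continuous_coord c).tendsto y).comp hy
  have h2 : Tendsto (fun n => (localLin Λ M (u n) c : ℂ)) atTop (𝓝 (localLin Λ M x c)) := by
    simp only [localLin_apply]
    exact tendsto_finsetSum _ fun z _ =>
      (((continuous_coord (patch Λ c z)).tendsto x).comp hu).const_mul _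
  exact tendsto_nhds_unique h1 h2

/-- The bounded operator `M ⊗ 1`. -/
noncomputable def localOp (Λ : Finset Bond) (M : Matrix (Λ → G) (Λ → G) ℂ) :
    Hilb G →L[ℂ] Hilb G := ⟨localLin Λ M, continuous_localLin Λ M⟩

/-- The defining formula of `M ⊗ 1`. -/
theorem localOp_apply (Λ : Finset Bond) (M : Matrix (Λ → G) (Λ → G) ℂ) (ψ : Hilb G)
    (c : Bond → G) :
    localOp Λ M ψ c = ∑ x : Λ → G, M (res Λ c) x * ψ (patch Λ c x) := rfl

theorem localOp_single [DecidableEq (Bond → G)] (Λ : Finset Bond)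
    (M : Matrix (Λ → G) (Λ → G) ℂ) (c : Bond → G) :
    localOp Λ M (lp.single 2 c (1 : ℂ)) =
      ∑ x : Λ → G, M x (res Λ c) • (lp.single 2 (patch Λ c x) (1 : ℂ) : Hilb G) := by
  apply lp.ext; funext d
  rw [localOp_apply, lp.coeFn_sum, Finset.sum_apply]
  simp only [lp.coeFn_smul, Pi.smul_apply, lp.single_apply, Pi.single_apply, smul_eq_mul]
  by_cases h : patch Λ c (res Λ d) = d
  · have h' : patch Λ d (res Λ c) = c := by rw [← h, patch_patch, patch_res]
    rw [Finset.sum_eq_single (res Λ c), Finset.sum_eq_single (res Λ d)]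
    · simp [h, h']
    · intro x _ hx
      rw [if_neg, mul_zero]
      intro hd; exact hx (by rw [hd, res_patch])
    · simp
    · intro x _ hx
      rw [if_neg, mul_zero]
      intro hd; exact hx (by rw [← hd, res_patch])
    · simp
  · rw [Finset.sum_eq_zero, Finset.sum_eq_zero]
    · intro x _
      rw [if_neg, mul_zero]
      intro hd; apply h; rw [hd, res_patch]
    · intro x _
      rw [if_neg, mul_zero]
      intro hd; apply h; rw [← hd, patch_patch, patch_res]

variable [DecidableEq G]

/-- The embedding `M ↦ M ⊗ 1` of the matrix algebra `M_{|G|^|Λ|}(ℂ)`. -/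
noncomputable def embed (Λ : Finset Bond) :
    Matrix (Λ → G) (Λ → G) ℂ →⋆ₐ[ℂ] (Hilb G →L[ℂ] Hilb G) where
  toFun := localOp Λ
  map_one' := by
    ext ψ c
    simp [localOp_apply, Matrix.one_apply]
  map_mul' M N := by
    ext ψ c
    simp only [localOp_apply, Matrix.mul_apply, mul_apply_eq_comp, res_patch,
      patch_patch, Finset.sum_mul, Finset.mul_sum]
    rw [Finset.sum_comm]
    simp only [mul_assoc]
  map_zero' := by
    ext ψ c
    simp [localOp_apply]
  map_add' M N := by
    ext ψ c
    simp [localOp_apply, add_mul, Finset.sum_add_distrib]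
  commutes' k := by
    ext ψ c
    simp [localOp_apply, Algebra.algebraMap_eq_smul_one, Matrix.one_apply]
  map_star' M := by
    classical
    ext ψ c
    have h := ContinuousLinearMap.adjoint_inner_right (localOp Λ M)
      (lp.single 2 c (1 : ℂ) : Hilb G) ψ
    rw [lp.inner_single_left, localOp_single, sum_inner] at h
    simp only [inner_smul_left, lp.inner_single_left] at h
    rw [ContinuousLinearMap.star_eq_adjoint, localOp_apply]
    simpa [Matrix.star_apply] using h.symm

theorem embed_apply (Λ : Finset Bond) (M : Matrix (Λ → G) (Λ → G) ℂ) (ψ : Hilb G)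
    (c : Bond → G) :
    embed Λ M ψ c = ∑ x : Λ → G, M (res Λ c) x * ψ (patch Λ c x) := rfl

/-- The matrix algebra of `Λ` acts faithfully. -/
theorem embed_injective (Λ : Finset Bond) : Function.Injective (embed (G := G) Λ) := by
  classical
  intro M N h
  ext a b
  have hb := congrArg (fun T : Hilb G →L[ℂ] Hilb G =>
    (T (lp.single 2 (patch Λ 1 b) (1 : ℂ)) (patch Λ 1 a) : ℂ)) h
  have key : ∀ x : Λ → G, patch Λ 1 x = patch Λ 1 b ↔ x = b := fun x =>
    ⟨fun hx => by simpa using congrArg (res Λ) hx, fun hx => by rw [hx]⟩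
  simpa [embed_apply, Pi.single_apply, key] using hb

end Embedding

section Model

variable (G : Type*) [CommGroup G] [Fintype G] [DecidableEq G]

/-- `𝒜_Λ`, the algebra of observables of the finite set of bonds `Λ`. -/
noncomputable def localAlg (Λ : Finset Bond) : StarSubalgebra ℂ (Hilb G →L[ℂ] Hilb G) :=
  (embed (G := G) Λ).range

variable {G} in
/-- The local algebras are increasing in `Λ`; in particular they are upward directed. -/
theorem localAlg_mono {Λ Λ' : Finset Bond} (hΛ : Λ ⊆ Λ') : localAlg G Λ ≤ localAlg G Λ' := by
  rintro _ ⟨M, rfl⟩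
  let r : (Λ' → G) → (Λ → G) := fun a e => a ⟨e, hΛ e.2⟩
  let p : (Λ' → G) → (Λ → G) → (Λ' → G) :=
    fun a x e => if h : (e : Bond) ∈ Λ then x ⟨e, h⟩ else a e
  refine ⟨Matrix.of fun a b => ∑ x : Λ → G, if b = p a x then M (r a) x else 0, ?_⟩
  ext ψ c
  change embed Λ' _ ψ c = embed Λ M ψ c
  simp only [embed_apply, Matrix.of_apply, Finset.sum_mul]
  rw [Finset.sum_comm]
  refine Finset.sum_congr rfl fun x _ => ?_
  have : patch Λ' c (p (res Λ' c) x) = patch Λ c x := by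
    funext e
    by_cases h : e ∈ Λ
    · simp [patch, p, h, hΛ h]
    · by_cases h' : e ∈ Λ' <;> simp [patch, p, h, h', res]
  simp only [ite_mul, zero_mul, Finset.sum_ite_eq', Finset.mem_univ, if_true, this]
  rfl

/-- The quasi-local algebra `𝒜`: the norm closure of the union of the local algebras (which is
an algebra, since the local algebras are upward directed). -/
noncomputable def quasiLocal : StarSubalgebra ℂ (Hilb G →L[ℂ] Hilb G) :=
  (⨆ Λ : Finset Bond, localAlg G Λ).topologicalClosure

/-- The local observables `𝒜_loc`, the union of the local algebras, as a subset of `𝒜`. -/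
def localObs : Set (quasiLocal G) :=
  {a | ∃ Λ : Finset Bond, (a : Hilb G →L[ℂ] Hilb G) ∈ localAlg G Λ}

variable {G}

theorem embed_mem (Λ : Finset Bond) (M : Matrix (Λ → G) (Λ → G) ℂ) :
    embed Λ M ∈ quasiLocal G :=
  StarSubalgebra.le_topologicalClosure _
    (le_iSup (fun Λ : Finset Bond => localAlg G Λ) Λ ⟨M, rfl⟩)

/-- The local observable of `𝒜` given by a matrix on `Λ`. -/
noncomputable def obs (Λ : Finset Bond) (M : Matrix (Λ → G) (Λ → G) ℂ) : quasiLocal G :=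
  ⟨embed Λ M, embed_mem Λ M⟩

/-! ### Star and plaquette operators -/

/-- The gauge transformation at `v` by `g`: it multiplies a configuration by `g` on the bonds
that leave `v`, by `g⁻¹` on those that arrive at `v`, and by `1` elsewhere. -/
def gauge (v : Vertex) (g : G) : Bond → G :=
  fun e => (if e.source = v then g else 1) * (if e.target = v then g⁻¹ else 1)

/-- The orientation of a bond of the plaquette of `f`: `1` if it is oriented clockwise with
respect to `f` (the left and the top bond), `-1` otherwise (the right and the bottom bond). -/
def orient (f : Face) (e : Bond) : ℤ :=
  if e = (f, true) ∨ e = ((f.1, f.2 + 1), false) then 1 else -1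

/-- The clockwise monodromy around `f` of a configuration on the plaquette of `f`. -/
def monodromy (f : Face) (a : plaquette f → G) : G :=
  ∏ e : plaquette f, a e ^ orient f e

/-- `A_v^g |a⟩ = |gauge · a⟩`. -/
noncomputable def starOp (v : Vertex) (g : G) : quasiLocal G :=
  obs (starAt v) (Matrix.of fun a b => if a = res (starAt v) (gauge v g) * b then 1 else 0)

/-- `B_f^h |a⟩ = |a⟩` if the monodromy of `a` around `f` is `h`, and `0` otherwise. -/
noncomputable def faceOp (f : Face) (h : G) : quasiLocal G :=
  obs (plaquette f) (Matrix.diagonal fun a => if monodromy f a = h then 1 else 0)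

/-- `A_v = |G|⁻¹ ∑_g A_v^g`. -/
noncomputable def starTerm (G : Type*) [CommGroup G] [Fintype G] [DecidableEq G] (v : Vertex) :
    quasiLocal G :=
  (Fintype.card G : ℂ)⁻¹ • ∑ g : G, starOp v g

/-- `B_f = B_f^e`. -/
noncomputable def faceTerm (G : Type*) [CommGroup G] [Fintype G] [DecidableEq G] (f : Face) :
    quasiLocal G :=
  faceOp f (1 : G)

variable (G) in
/-- The Hamiltonian `H_L` of the box `Λ_L`. -/
noncomputable def ham (L : ℕ) : quasiLocal G :=
  ∑ v ∈ verts L, (1 - starTerm G v) + ∑ f ∈ faces L, (1 - faceTerm G f)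

theorem starOp_apply (v : Vertex) (g : G) (ψ : Hilb G) (c : Bond → G) :
    (starOp v g : Hilb G →L[ℂ] Hilb G) ψ c = ψ ((gauge v g)⁻¹ * c) := by
  change embed (starAt v) _ ψ c = _
  rw [embed_apply, Finset.sum_eq_single (res (starAt v) ((gauge v g)⁻¹ * c))]
  · have h1 : res (starAt v) c =
        res (starAt v) (gauge v g) * res (starAt v) ((gauge v g)⁻¹ * c) := by
      funext e; simp [res]
    have h2 : patch (starAt v) c (res (starAt v) ((gauge v g)⁻¹ * c)) = (gauge v g)⁻¹ * c := by
      funext e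
      by_cases h : e ∈ starAt v
      · simp [patch, h, res]
      · have h' := h
        rw [mem_star_iff, not_or] at h'
        simp [patch, h, gauge, h'.1, h'.2]
    simp only [Matrix.of_apply, ← h1, h2, if_true, one_mul]
  · intro x _ hx
    rw [Matrix.of_apply, if_neg, zero_mul]
    intro h; apply hx
    funext e
    have := congrFun h e
    simp only [res, Pi.mul_apply] at this
    simp [res, this]
  · simp

theorem faceOp_apply (f : Face) (h : G) (ψ : Hilb G) (c : Bond → G) :
    (faceOp f h : Hilb G →L[ℂ] Hilb G) ψ c =
      if monodromy f (res (plaquette f) c) = h then ψ c else 0 := by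
  change embed (plaquette f) _ ψ c = _
  rw [embed_apply]
  simp [Matrix.diagonal_apply]

theorem starOp_commute (v w : Vertex) (g h : G) : Commute (starOp v g) (starOp w h) := by
  apply Subtype.ext; ext ψ c
  change (starOp v g : Hilb G →L[ℂ] Hilb G) ((starOp w h : Hilb G →L[ℂ] Hilb G) ψ) c =
    (starOp w h : Hilb G →L[ℂ] Hilb G) ((starOp v g : Hilb G →L[ℂ] Hilb G) ψ) c
  simp only [starOp_apply, mul_left_comm]

theorem faceOp_commute (f f' : Face) (g h : G) : Commute (faceOp f g) (faceOp f' h) := by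
  apply Subtype.ext; ext ψ c
  change (faceOp f g : Hilb G →L[ℂ] Hilb G) ((faceOp f' h : Hilb G →L[ℂ] Hilb G) ψ) c =
    (faceOp f' h : Hilb G →L[ℂ] Hilb G) ((faceOp f g : Hilb G →L[ℂ] Hilb G) ψ) c
  simp only [faceOp_apply]
  split_ifs <;> rfl

/-! ### Charge projectors -/

/-- The character group `Ĝ`. -/
abbrev Chars (G : Type*) [CommGroup G] : Type _ := G →* ℂˣ

noncomputable instance (G : Type*) [CommGroup G] [Fintype G] : Fintype (Chars G) :=
  Fintype.ofFinite _

/-- `D_v^χ = |G|⁻¹ ∑_g conj (χ g) A_v^g`. -/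
noncomputable def electric (v : Vertex) (χ : Chars G) : quasiLocal G :=
  (Fintype.card G : ℂ)⁻¹ • ∑ g : G, (starRingEnd ℂ) (χ g : ℂ) • starOp v g

/-- `D_f^c = B_f^c`. -/
noncomputable def magnetic (f : Face) (c : G) : quasiLocal G := faceOp f c

theorem electric_commute (v w : Vertex) (χ ξ : Chars G) :
    Commute (electric v χ) (electric w ξ) := by
  unfold electric
  refine Commute.smul_left (Commute.smul_right ?_ _) _
  refine Commute.sum_left _ _ _ fun g _ => Commute.sum_right _ _ _ fun h _ => ?_
  exact Commute.smul_left (Commute.smul_right (starOp_commute v w g h) _) _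

open scoped Classical in
/-- `D_L^χ`: the sum over all `(χ_v)_v` with `∏_v χ_v = χ` of the products `∏_v D_v^{χ_v}`, where
`v` runs over the stars in `Λ_L`. -/
noncomputable def electricTotal (L : ℕ) (χ : Chars G) : quasiLocal G :=
  ∑ κ ∈ (Finset.univ : Finset (verts L → Chars G)).filter (fun κ => ∏ v, κ v = χ),
    Finset.univ.noncommProd (fun v : verts L => electric (v : Vertex) (κ v))
      fun v _ w _ _ => electric_commute (v : Vertex) (w : Vertex) (κ v) (κ w)

/-- `D_L^c`: the sum over all `(c_f)_f` with `∏_f c_f = c` of the products `∏_f D_f^{c_f}`, where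
`f` runs over the plaquettes in `Λ_L`. -/
noncomputable def magneticTotal (L : ℕ) (c : G) : quasiLocal G :=
  ∑ κ ∈ (Finset.univ : Finset (faces L → G)).filter (fun κ => ∏ f, κ f = c),
    Finset.univ.noncommProd (fun f : faces L => magnetic (f : Face) (κ f))
      fun f _ f' _ _ => faceOp_commute (f : Face) (f' : Face) (κ f) (κ f')

/-- `D_L^{χ,c} = D_L^χ D_L^c`, the projector on total charge `(χ, c)` in `Λ_L`. -/
noncomputable def charge (L : ℕ) (χ : Chars G) (c : G) : quasiLocal G :=
  electricTotal L χ * magneticTotal L c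

/-! ### States and ground states -/

variable (G)

/-- The set of all states of `𝒜`, in the dual of `𝒜` with the weak* topology. -/
def states : Set (WeakDual ℂ (quasiLocal G)) :=
  {ω | (∀ a : quasiLocal G, 0 ≤ ω (star a * a)) ∧ ω 1 = 1}

/-- The graph of the derivation `a ↦ lim_L [H_L, a]` on `𝒜_loc`. -/
def derivLocal : Set (quasiLocal G × quasiLocal G) :=
  {p | p.1 ∈ localObs G ∧ Tendsto (fun L => ham G L * p.1 - p.1 * ham G L) atTop (𝓝 p.2)}

/-- The graph of the generator `δ` of the dynamics, the closure of the derivation on `𝒜_loc`. -/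
def generator : Set (quasiLocal G × quasiLocal G) := closure (derivLocal G)

/-- The set `K` of infinite volume ground states: `ω (a* δ(a)) ≥ 0` for all `a ∈ dom δ`. -/
def groundStates : Set (WeakDual ℂ (quasiLocal G)) :=
  {ω | ω ∈ states G ∧ ∀ p ∈ generator G, 0 ≤ ω (star p.1 * p.2)}

/-- The set `K⁰` of frustration-free ground states: every interaction term has energy zero. -/
def frustrationFree : Set (WeakDual ℂ (quasiLocal G)) :=
  {ω | ω ∈ groundStates G ∧ (∀ v : Vertex, ω (1 - starTerm G v) = 0) ∧
    ∀ f : Face, ω (1 - faceTerm G f) = 0}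

variable {G}

/-- The set `K^{χ,c}`: the states `φ` for which there is a ground state `ω` such that
`lim_L ω(D_L^{χ,c})` exists and is positive, and `φ` is the weak* limit of the functionals
`ω(· D_L^{χ,c}) / ω(D_L^{χ,c})`. -/
def chargedGroundStates (χ : Chars G) (c : G) : Set (WeakDual ℂ (quasiLocal G)) :=
  {φ | φ ∈ states G ∧ ∃ ω ∈ groundStates G,
    (∃ l : ℝ, 0 < l ∧ Tendsto (fun L => ω (charge L χ c)) atTop (𝓝 (l : ℂ))) ∧
    ∀ a : quasiLocal G,
      Tendsto (fun L => ω (a * charge L χ c) / ω (charge L χ c)) atTop (𝓝 (φ a))}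

end Model

end KitaevQD

/-!
The model is a pair of commuting *charge systems* on `ℤ × ℤ`: at every vertex the electric charge,
with values in the group of characters of `G`, and at every face the magnetic charge, with values
in `G`, are measured by commuting projections, and `H_L` counts the non-trivial charges in the box.
Everything about the model that the theorem depends on is the following.

* The total charge of a large box commutes with a given local observable: the product of the
  gauge transformations at all vertices of the box acts on its boundary only, and so does the
  product of the monodromies around all its faces (`electric_total_commute`,
  `magnetic_total_commute`).
* A charge can be moved from any site to any other by a local unitary that does not affect the
  charges of the other species, and along a ray by unitaries that recede to infinity
  (`transports_electric`, `transports_magnetic`, `mobile_chargePair`, `mobile_swap_chargePair`).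

*Ground states* are the states with at most one electric and at most one magnetic charge
(`groundStates_eq`). Two charges of the same species can be merged by a local unitary, which lowers
the energy, so that a ground state gives them probability zero (`exists_energy_commutator`,
`atMostOne_of_groundState`). Conversely, a configuration of total charge different from `1` has at
least one charge, so that `H - (1 - D^1) ≥ 0` for the total charge projection `D^1` of the box; this
operator is null in a state with at most one charge, and `D^1` commutes with local observables
(`map_star_mul_commutator_energy_nonneg`).

*Conditional states.* For a state with at most one charge, the probability that the box has a given
non-trivial total charge increases with the box, so that the total charge projections form a Cauchy
sequence in the GNS space (`gnsCauchy_total`) and the state can be restricted to total charge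
`(χ, c)` at infinity (`exists_restriction`). It follows that `K^{χ,c}` is the *sector* `(χ, c)`,
the set of the ground states `ω` with `ω (D_L^{χ,c}) → 1` (`mem_sector_iff`), and that `K^0` is the
sector `(1, 1)` (`frustrationFree_eq`).

*The inclusion `⊆`.* The states of the sector `(χ, c)` have all their charges in `{1, χ}` and
`{1, c}`. This condition is weak* closed, and a ground state that satisfies it is the mixture of
its restrictions to the four possible total charges (`carrier_subset_convexHull`).

*The inclusion `⊇`.* Sectors are convex, so it suffices to approximate the states of the sector
`(1, c)` by states of `(χ, c)`, and similarly for magnetic charges. Conjugation with string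
operators along the ray from `(n + m, 0)` to `(n, 0)`, followed by a weak* limit point as `m → ∞`,
places a charge `χ` at `(n, 0)` with no compensating charge elsewhere; as `n → ∞` this charge
disappears from the sight of every local observable (`sector_one_subset_closure`).
-/

namespace KitaevQD

set_option linter.unusedSectionVars false

/-! ### Commuting families of charge measurements -/

/-- A family of commuting projective measurements with outcomes in `A`, one at each site of
`ℤ × ℤ`, together with an increasing exhaustion of `ℤ × ℤ` by finite regions. The outcome at a
site is its charge. -/
structure ChargeSystem (R A : Type*) [Ring R] [StarRing R] [Fintype A] where
  /-- The projection onto charge `a` at the site `i`. -/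
  proj : ℤ × ℤ → A → R
  star_proj : ∀ i a, star (proj i a) = proj i a
  proj_mul_self : ∀ i a, proj i a * proj i a = proj i a
  proj_mul_of_ne : ∀ i a b, a ≠ b → proj i a * proj i b = 0
  sum_proj : ∀ i, ∑ a, proj i a = 1
  commute : ∀ i j a b, Commute (proj i a) (proj j b)
  /-- The sites in the box of size `L`. -/
  region : ℕ → Finset (ℤ × ℤ)
  region_mono : Monotone region
  exists_mem_region : ∀ i, ∃ L, i ∈ region L

namespace ChargeSystem

section Calculus

open scoped IsMulCommutative

variable {R A : Type*} [Ring R] [StarRing R] [Fintype A] (S : ChargeSystem R A)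

theorem eventually_mem_region (i : ℤ × ℤ) : ∀ᶠ L in atTop, i ∈ S.region L := by
  obtain ⟨L, hL⟩ := S.exists_mem_region i
  exact eventually_atTop.2 ⟨L, fun M hM => S.region_mono hM hL⟩

theorem proj_mul_proj [DecidableEq A] (i : ℤ × ℤ) (a b : A) :
    S.proj i a * S.proj i b = if a = b then S.proj i b else 0 := by
  split_ifs with h
  · rw [h, S.proj_mul_self]
  · exact S.proj_mul_of_ne i a b h

theorem pairwise_commute {L : ℕ} (κ : S.region L → A) (s : Set (S.region L)) :
    s.Pairwise (Function.onFun Commute fun i : S.region L => S.proj i (κ i)) :=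
  fun i _ j _ _ => S.commute i j (κ i) (κ j)

/-- The projection onto the charge configuration `κ` in the box. -/
noncomputable def joint (L : ℕ) (κ : S.region L → A) : R :=
  Finset.univ.noncommProd (fun i : S.region L => S.proj i (κ i)) (S.pairwise_commute κ _)

variable {S} {L : ℕ}

theorem proj_commute_joint (i : ℤ × ℤ) (a : A) (κ : S.region L → A) :
    Commute (S.proj i a) (S.joint L κ) :=
  Finset.noncommProd_commute _ _ _ _ fun j _ => S.commute i j a (κ j)

theorem proj_mul_joint [DecidableEq A] (i : S.region L) (a : A) (κ : S.region L → A) :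
    S.proj i a * S.joint L κ = if a = κ i then S.joint L κ else 0 := by
  classical
  have h := Finset.mul_noncommProd_erase Finset.univ (Finset.mem_univ i)
    (fun i : S.region L => S.proj i (κ i)) (S.pairwise_commute κ _)
  rw [joint, ← h, ← mul_assoc, proj_mul_proj]
  split_ifs <;> simp

theorem star_joint (κ : S.region L → A) : star (S.joint L κ) = S.joint L κ := by
  have key : ∀ s : Finset (S.region L),
      star (s.noncommProd (fun i : S.region L => S.proj i (κ i)) (S.pairwise_commute κ _)) =
      s.noncommProd (fun i : S.region L => S.proj i (κ i)) (S.pairwise_commute κ _) := by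
    classical
    intro s
    induction s using Finset.induction_on with
    | empty => rw [Finset.noncommProd_empty, star_one]
    | insert i s hi ih =>
      rw [Finset.noncommProd_insert_of_notMem _ _ _ _ hi, star_mul, ih, S.star_proj]
      exact (Finset.noncommProd_commute _ _ _ _ fun _ _ => S.commute _ _ _ _).symm
  exact key _

theorem joint_mul_joint [DecidableEq A] (κ μ : S.region L → A) :
    S.joint L κ * S.joint L μ = if κ = μ then S.joint L μ else 0 := by
  split_ifs with h
  · subst h
    rw [joint, ← Finset.noncommProd_mul_distrib _ _ _ _
      fun _ _ _ _ _ => S.commute _ _ _ _]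
    exact Finset.noncommProd_congr rfl (fun i _ => S.proj_mul_self _ _) _
  · obtain ⟨i, hi⟩ := Function.ne_iff.1 h
    have h1 : S.joint L μ = S.proj i (μ i) * S.joint L μ := by rw [proj_mul_joint, if_pos rfl]
    rw [h1, ← mul_assoc, ← (proj_commute_joint (i : ℤ × ℤ) (μ i) κ).eq, proj_mul_joint,
      if_neg (Ne.symm hi), zero_mul]

variable [Algebra ℂ R]

/-- The joint projections form a resolution of the identity: expand `∏ᵢ ∑ₐ proj i a = 1` in the
commutative algebra generated by all the projections. -/
theorem sum_joint [DecidableEq A] : ∑ κ, S.joint L κ = 1 := by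
  let T : Set R := Set.range fun p : (ℤ × ℤ) × A => S.proj p.1 p.2
  have hT : ∀ x ∈ T, ∀ y ∈ T, x * y = y * x := by
    rintro _ ⟨p, rfl⟩ _ ⟨q, rfl⟩
    exact S.commute _ _ _ _
  have := Algebra.isMulCommutative_adjoin ℂ hT
  let D : S.region L → A → Algebra.adjoin ℂ T :=
    fun i a => ⟨S.proj i a, Algebra.subset_adjoin ⟨((i : ℤ × ℤ), a), rfl⟩⟩
  have h1 : ∀ i, ∑ a, D i a = 1 := by
    intro i
    apply Subtype.ext
    simpa [D] using S.sum_proj i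
  have h2 : ∑ κ : S.region L → A, ∏ i, D i (κ i) = 1 := by
    have := Finset.prod_univ_sum (fun _ : S.region L => (Finset.univ : Finset A)) D
    simpa [h1] using this.symm
  have h3 := congrArg (Algebra.adjoin ℂ T).val h2
  rw [map_sum, map_one] at h3
  rw [← h3]
  refine Finset.sum_congr rfl fun κ _ => ?_
  rw [← Finset.noncommProd_eq_prod]
  exact (Finset.map_noncommProd Finset.univ (fun i => D i (κ i))
    (fun _ _ _ _ _ => Commute.all _ _) (Algebra.adjoin ℂ T).val).symm

variable [StarModule ℂ R]

variable (S L) in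
/-- The functional calculus of the charge measurements in the box: it sends a function `f` of the
charge configuration to `∑ κ, f κ • joint κ`. -/
noncomputable def calculus : ((S.region L → A) → ℂ) →⋆ₐ[ℂ] R := by
  classical
  exact
  { toFun := fun f => ∑ κ, f κ • S.joint L κ
    map_one' := by simpa using sum_joint
    map_mul' := fun f g => by
      simp [Finset.sum_mul, Finset.mul_sum, joint_mul_joint, smul_smul, mul_comm]
    map_zero' := by simp
    map_add' := fun f g => by simp [add_smul, Finset.sum_add_distrib]
    commutes' := fun k => by
      simp [Algebra.algebraMap_eq_smul_one, ← Finset.smul_sum, sum_joint]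
    map_star' := fun f => by simp [star_sum, star_smul, star_joint] }

theorem calculus_apply (f : (S.region L → A) → ℂ) :
    S.calculus L f = ∑ κ, f κ • S.joint L κ := rfl

open scoped Classical in
theorem calculus_proj (i : S.region L) (a : A) :
    S.calculus L (fun κ => if κ i = a then 1 else 0) = S.proj i a := by
  rw [← mul_one (S.proj i a), ← sum_joint (S := S) (L := L), Finset.mul_sum, calculus_apply]
  refine Finset.sum_congr rfl fun κ _ => ?_
  rw [proj_mul_joint]
  by_cases h : κ i = a
  · simp [h]
  · simp [h, Ne.symm h]

variable (S L) in
theorem calculus_single (i : S.region L) (f : A → ℂ) :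
    S.calculus L (fun κ => f (κ i)) = ∑ a, f a • S.proj i a := by
  classical
  have h : (fun κ : S.region L → A => f (κ i)) =
      ∑ a, f a • fun κ => if κ i = a then (1 : ℂ) else 0 := by
    funext κ
    simp [Finset.sum_apply]
  rw [h, map_sum]
  exact Finset.sum_congr rfl fun a _ => by rw [map_smul, calculus_proj]

theorem commute_calculus {x : R} (h : ∀ i a, Commute x (S.proj i a))
    (f : (S.region L → A) → ℂ) : Commute x (S.calculus L f) :=
  Commute.sum_right _ _ _ fun _ _ =>
    (Finset.noncommProd_commute _ _ _ _ fun _ _ => h _ _).smul_right _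

variable [CommGroup A]

open scoped Classical in
variable (S L) in
/-- The projection onto total charge `χ` in the box. -/
noncomputable def total (χ : A) : R :=
  S.calculus L fun κ => if ∏ i, κ i = χ then 1 else 0

open scoped Classical in
variable (S L) in
theorem star_total (χ : A) : star (S.total L χ) = S.total L χ := by
  rw [total, ← map_star]
  congr 1
  funext κ
  change star (if ∏ i, κ i = χ then (1 : ℂ) else 0) = _
  split_ifs <;> simp

open scoped Classical in
variable (S L) in
theorem total_mul_self (χ : A) : S.total L χ * S.total L χ = S.total L χ := by
  rw [total, ← map_mul]
  congr 1
  funext κ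
  change (if ∏ i, κ i = χ then (1 : ℂ) else 0) * (if ∏ i, κ i = χ then 1 else 0) = _
  split_ifs <;> simp

variable (S L) in
theorem sum_total : ∑ χ, S.total L χ = 1 := by
  classical
  simp only [total]
  rw [← map_sum, ← map_one (S.calculus L)]
  congr 1
  funext κ
  rw [Finset.sum_apply, Finset.sum_ite_eq, if_pos (Finset.mem_univ _), Pi.one_apply]

theorem commute_total {x : R} (h : ∀ i a, Commute x (S.proj i a)) (χ : A) :
    Commute x (S.total L χ) :=
  commute_calculus h _

/-- For a character `w` of the charge group, `w` of the total charge is the product over the sites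
of `w` of the charges. -/
theorem calculus_prod_induction (w : A →* ℂ) {motive : Finset (ℤ × ℤ) → R → Prop}
    (h1 : motive ∅ 1)
    (hmul : ∀ i s x, i ∉ s → motive s x → motive (insert i s) ((∑ a, w a • S.proj i a) * x)) :
    motive (S.region L) (S.calculus L fun κ => w (∏ i, κ i)) := by
  classical
  have key : ∀ s : Finset (S.region L), motive (s.map (Function.Embedding.subtype _))
      (S.calculus L (∏ i ∈ s, fun κ => w (κ i))) := by
    intro s
    induction s using Finset.induction_on with
    | empty => simpa using h1
    | insert i s hi ih =>
      rw [Finset.prod_insert hi, map_mul, Finset.map_insert, calculus_single S L i w]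
      exact hmul _ _ _ (by simpa using hi) ih
  have h := key Finset.univ
  have e : (∏ i : S.region L, fun κ : S.region L → A => w (κ i)) = fun κ => w (∏ i, κ i) := by
    funext κ
    rw [Finset.prod_apply, map_prod]
  rwa [Finset.univ_eq_attach, Finset.attach_map_val, ← Finset.univ_eq_attach, e] at h

open scoped Classical in
/-- The value of the total charge projection in a simultaneous eigenvector of the charges. -/
theorem apply_total (ev : R →ₗ[ℂ] ℂ) (μ : ℤ × ℤ → A)
    (hev : ∀ i a x, ev (S.proj i a * x) = if μ i = a then ev x else 0) (χ : A) :
    ev (S.total L χ) = (if ∏ i ∈ S.region L, μ i = χ then 1 else 0) * ev 1 := by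
  have h0 : ∀ κ : S.region L → A, κ ≠ (fun i : S.region L => μ i) → ev (S.joint L κ) = 0 := by
    intro κ hκ
    obtain ⟨i, hi⟩ := Function.ne_iff.1 hκ
    have h2 := proj_mul_joint i (κ i) κ
    rw [if_pos rfl] at h2
    rw [← h2, hev, if_neg (Ne.symm hi)]
  have h1 : ev (S.joint L fun i : S.region L => μ i) = ev 1 := by
    rw [← sum_joint (S := S) (L := L), map_sum, Finset.sum_eq_single fun i : S.region L => μ i]
    · exact fun κ _ hκ => h0 κ hκ
    · simp
  rw [total, calculus_apply, map_sum, Finset.sum_eq_single fun i : S.region L => μ i]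
  · rw [map_smul, h1, smul_eq_mul, ← Finset.prod_coe_sort (S.region L) μ]
  · intro κ _ hκ
    rw [map_smul, h0 κ hκ, smul_zero]
  · simp

end Calculus

end ChargeSystem

/-! ### The seminorm of a positive functional -/

section Positive

variable {R : Type*} [NormedRing R] [StarRing R] [NormedAlgebra ℂ R] [StarModule ℂ R]

/-- Positivity of a functional on a `*`-algebra. -/
def IsPositive (ω : WeakDual ℂ R) : Prop := ∀ a : R, 0 ≤ ω (star a * a)

theorem IsPositive.map_star {ω : WeakDual ℂ R} (hω : IsPositive ω) (a : R) :
    ω (star a) = (starRingEnd ℂ) (ω a) := by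
  have h1 := (Complex.nonneg_iff.1 (hω (1 + a))).2
  have h2 := (Complex.nonneg_iff.1 (hω (1 + Complex.I • a))).2
  have h0 := (Complex.nonneg_iff.1 (hω 1)).2
  have h3 := (Complex.nonneg_iff.1 (hω a)).2
  simp only [star_add, star_one, star_smul, mul_add, add_mul, one_mul, mul_one, map_add, map_smul,
    smul_mul_assoc, mul_smul_comm, smul_eq_mul, Complex.add_im, Complex.mul_im, Complex.star_def,
    Complex.conj_I, Complex.neg_re, Complex.neg_im, Complex.I_re, Complex.I_im, Complex.mul_re]
    at h0 h1 h2 h3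
  apply Complex.ext
  · rw [Complex.conj_re]; linarith
  · rw [Complex.conj_im]; linarith

theorem isClosed_map_star_mul_nonneg [NormedStarGroup R] (ω : WeakDual ℂ R) :
    IsClosed {p : R × R | 0 ≤ ω (star p.1 * p.2)} :=
  isClosed_le continuous_const
    ((map_continuous ω).comp ((continuous_star.comp continuous_fst).mul continuous_snd))

theorem tendsto_map_mul (ω : WeakDual ℂ R) (x : R) {y : ℕ → R} {z : R}
    (h : Tendsto y atTop (𝓝 z)) : Tendsto (fun L => ω (x * y L)) atTop (𝓝 (ω (x * z))) :=
  ((map_continuous ω).tendsto _).comp (h.const_mul x)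

/-- The semi-inner product `⟨x, y⟩ = ω (x* y)` of the GNS construction. -/
@[reducible] noncomputable def IsPositive.gnsCore {ω : WeakDual ℂ R} (hω : IsPositive ω) :
    PreInnerProductSpace.Core ℂ R where
  inner x y := ω (star x * y)
  conj_inner_symm x y := by
    rw [← hω.map_star, star_mul, star_star]
  re_inner_nonneg x := (Complex.nonneg_iff.1 (hω x)).1
  add_left x y z := by simp [add_mul]
  smul_left x y r := by simp

/-- The GNS seminorm `‖x‖_ω = ω (x* x)^{1/2}`. -/
noncomputable def gnsNorm (ω : WeakDual ℂ R) (x : R) : ℝ := √(ω (star x * x)).re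

theorem gnsNorm_nonneg (ω : WeakDual ℂ R) (x : R) : 0 ≤ gnsNorm ω x := Real.sqrt_nonneg _

theorem gnsNorm_neg (ω : WeakDual ℂ R) (x : R) : gnsNorm ω (-x) = gnsNorm ω x := by
  simp [gnsNorm]

namespace IsPositive

variable {ω : WeakDual ℂ R} (hω : IsPositive ω)
include hω

theorem gnsNorm_eq_zero {x : R} (h : ω (star x * x) = 0) : gnsNorm ω x = 0 := by
  simp [gnsNorm, h]

theorem norm_map_star_mul_le (x y : R) :
    ‖ω (star x * y)‖ ≤ gnsNorm ω x * gnsNorm ω y :=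
  let _ := hω.gnsCore
  InnerProductSpace.Core.norm_inner_le_norm (𝕜 := ℂ) x y

theorem gnsNorm_add_le (x y : R) : gnsNorm ω (x + y) ≤ gnsNorm ω x + gnsNorm ω y := by
  let _ := hω.gnsCore
  let _ := InnerProductSpace.Core.toSeminormedAddCommGroup (𝕜 := ℂ) (F := R)
  exact norm_add_le x y

theorem gnsNorm_sum_le {ι : Type*} (s : Finset ι) (x : ι → R) :
    gnsNorm ω (∑ i ∈ s, x i) ≤ ∑ i ∈ s, gnsNorm ω (x i) := by
  classical
  induction s using Finset.induction_on with
  | empty => simp [gnsNorm]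
  | insert i s hi ih =>
    rw [Finset.sum_insert hi, Finset.sum_insert hi]
    exact (hω.gnsNorm_add_le _ _).trans (by gcongr)

theorem map_projection_nonneg {p : R} (h1 : star p = p) (h2 : p * p = p) : 0 ≤ ω p := by
  have := hω p
  rwa [h1, h2] at this

theorem gnsNorm_projection_mul_le {p : R} (h1 : star p = p) (h2 : p * p = p) (x : R) :
    gnsNorm ω (p * x) ≤ gnsNorm ω x := by
  refine Real.sqrt_le_sqrt ?_
  have h3 := hω ((1 - p) * x)
  have e1 : star ((1 - p) * x) * ((1 - p) * x) = star x * x - star (p * x) * (p * x) := by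
    have : star x * (p * (p * x)) = star x * (p * x) := by rw [← mul_assoc p p, h2]
    simp only [star_mul, star_sub, h1, mul_sub, sub_mul, one_mul, mul_assoc,
      this]
    abel
  rw [e1, map_sub] at h3
  have := (Complex.nonneg_iff.1 h3).1
  rw [Complex.sub_re] at this
  linarith

variable [NormedStarGroup R]

/-- For fixed `y`, the functional `x ↦ ω (y x)` is continuous for the GNS seminorm: the
Cauchy–Schwarz inequality bounds it by `ω (y y*)^{1/2} ‖x‖_ω`. -/
theorem exists_norm_map_mul_le :
    ∃ C : ℝ, 0 ≤ C ∧ ∀ y x : R, ‖ω (y * x)‖ ≤ C * ‖y‖ * gnsNorm ω x := by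
  refine ⟨√‖WeakDual.toStrongDual ω‖, Real.sqrt_nonneg _, fun y x => ?_⟩
  have h := hω.norm_map_star_mul_le (star y) x
  rw [star_star] at h
  refine h.trans (mul_le_mul_of_nonneg_right ?_ (gnsNorm_nonneg _ _))
  rw [← Real.sqrt_sq (norm_nonneg y), ← Real.sqrt_mul (norm_nonneg _)]
  refine Real.sqrt_le_sqrt ?_
  rw [star_star]
  refine (Complex.re_le_norm _).trans (((WeakDual.toStrongDual ω).le_opNorm _).trans ?_)
  gcongr
  refine (norm_mul_le _ _).trans_eq ?_
  rw [norm_star, sq]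

/-- The null vectors of the GNS seminorm form a left ideal on which `ω` vanishes. -/
theorem map_mul_eq_zero {x : R} (h : ω (star x * x) = 0) (y : R) : ω (y * x) = 0 := by
  obtain ⟨C, -, hC⟩ := hω.exists_norm_map_mul_le
  have := hC y x
  rw [hω.gnsNorm_eq_zero h, mul_zero] at this
  exact norm_le_zero_iff.1 this

end IsPositive

/-! ### Sequences that converge in the GNS space -/

/-- `x` is a Cauchy sequence for the GNS seminorm of `ω`. -/
def GNSCauchy (ω : WeakDual ℂ R) (x : ℕ → R) : Prop :=
  Tendsto (fun p : ℕ × ℕ => gnsNorm ω (x p.1 - x p.2)) atTop (𝓝 0)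

namespace IsPositive

variable {ω : WeakDual ℂ R} (hω : IsPositive ω)
include hω

theorem gnsCauchy_sum {ι : Type*} (s : Finset ι) (x : ι → ℕ → R)
    (h : ∀ i ∈ s, GNSCauchy ω (x i)) : GNSCauchy ω (fun L => ∑ i ∈ s, x i L) := by
  have h1 := tendsto_finsetSum s h
  rw [Finset.sum_const_zero] at h1
  refine squeeze_zero (fun _ => gnsNorm_nonneg _ _) (fun p => ?_) h1
  rw [← Finset.sum_sub_distrib]
  exact hω.gnsNorm_sum_le _ _

theorem gnsCauchy_sub {x y : ℕ → R} (hx : GNSCauchy ω x) (hy : GNSCauchy ω y) :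
    GNSCauchy ω (fun L => x L - y L) := by
  have h1 := hx.add hy
  rw [add_zero] at h1
  refine squeeze_zero (fun _ => gnsNorm_nonneg _ _) (fun p => ?_) h1
  have : x p.1 - y p.1 - (x p.2 - y p.2) = (x p.1 - x p.2) + -(y p.1 - y p.2) := by abel
  rw [this]
  exact (hω.gnsNorm_add_le _ _).trans_eq (by rw [gnsNorm_neg])

/-- Products of commuting projections that converge in the GNS space converge there. -/
theorem gnsCauchy_mul {x y : ℕ → R} (hx : GNSCauchy ω x) (hy : GNSCauchy ω y)
    (hxs : ∀ L, star (x L) = x L) (hxp : ∀ L, x L * x L = x L)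
    (hys : ∀ L, star (y L) = y L) (hyp : ∀ L, y L * y L = y L)
    (hc : ∀ L M, Commute (x L) (y M)) : GNSCauchy ω (fun L => x L * y L) := by
  have h1 := hx.add hy
  rw [add_zero] at h1
  refine squeeze_zero (fun _ => gnsNorm_nonneg _ _) (fun p => ?_) h1
  have : x p.1 * y p.1 - x p.2 * y p.2 =
      y p.1 * (x p.1 - x p.2) + x p.2 * (y p.1 - y p.2) := by
    rw [mul_sub, mul_sub, (hc p.1 p.1).eq, (hc p.2 p.1).eq]; abel
  rw [this]
  exact (hω.gnsNorm_add_le _ _).trans (add_le_add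
    (hω.gnsNorm_projection_mul_le (hys _) (hyp _) _)
    (hω.gnsNorm_projection_mul_le (hxs _) (hxp _) _))

theorem exists_tendsto_map_mul [NormedStarGroup R] {x : ℕ → R} (hx : GNSCauchy ω x) (y : R) :
    ∃ z : ℂ, Tendsto (fun L => ω (y * x L)) atTop (𝓝 z) := by
  obtain ⟨C, hC0, hC⟩ := hω.exists_norm_map_mul_le
  refine cauchySeq_tendsto_of_complete (cauchySeq_iff_tendsto_dist_atTop_0.2 ?_)
  have h1 := hx.const_mul (C * ‖y‖)
  rw [mul_zero] at h1
  refine squeeze_zero (fun _ => dist_nonneg) (fun p => ?_) h1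
  rw [dist_eq_norm, ← map_sub, ← mul_sub]
  exact hC _ _

end IsPositive

end Positive

/-! ### States with at most one charge -/

namespace ChargeSystem

section AtMostOne

variable {R A : Type*} [NormedRing R] [StarRing R] [NormedAlgebra ℂ R] [StarModule ℂ R]
  [NormedStarGroup R] [Fintype A] [CommGroup A] (S : ChargeSystem R A)

/-- The functional `ω` gives probability zero to non-trivial charges at two different sites. -/
def AtMostOne (ω : WeakDual ℂ R) : Prop :=
  ∀ i j a b, i ≠ j → a ≠ 1 → b ≠ 1 → ω (S.proj i a * S.proj j b) = 0

variable {S}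

theorem eq_one_or_mulSingle {ι : Type*} [DecidableEq ι] {κ : ι → A}
    (h : ∀ i j, i ≠ j → κ i = 1 ∨ κ j = 1) :
    κ = 1 ∨ ∃ i a, a ≠ 1 ∧ κ = Pi.mulSingle i a := by
  by_cases h1 : κ = 1
  · exact Or.inl h1
  · obtain ⟨i, hi⟩ := Function.ne_iff.1 h1
    refine Or.inr ⟨i, κ i, hi, funext fun j => ?_⟩
    rcases eq_or_ne j i with rfl | hj
    · simp
    · rw [Pi.mulSingle_eq_of_ne hj]
      exact (h i j hj.symm).resolve_left hi

variable {ω : WeakDual ℂ R} {L : ℕ} (hω : IsPositive ω) (h : S.AtMostOne ω)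

theorem map_mul_proj_mul_proj_eq_zero (hω : IsPositive ω) (h : S.AtMostOne ω)
    {i j : ℤ × ℤ} {a b : A} (hij : i ≠ j) (ha : a ≠ 1) (hb : b ≠ 1) (y : R) :
    ω (y * (S.proj i a * S.proj j b)) = 0 := by
  refine hω.map_mul_eq_zero ?_ y
  rw [star_mul, S.star_proj, S.star_proj, ((S.commute i j a b).eq).symm, mul_assoc,
    ← mul_assoc (S.proj j b), ((S.commute i j a b).eq).symm, mul_assoc, S.proj_mul_self,
    ← mul_assoc, S.proj_mul_self]
  exact h i j a b hij ha hb

include hω h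

/-- Functions of the charge configuration that vanish on the configurations with at most one
non-trivial charge are null for `ω`. -/
theorem map_mul_calculus_eq_zero {f : (S.region L → A) → ℂ} (h1 : f 1 = 0)
    (h2 : ∀ i a, a ≠ 1 → f (Pi.mulSingle i a) = 0) (y : R) :
    ω (y * S.calculus L f) = 0 := by
  classical
  rw [calculus_apply, Finset.mul_sum, map_sum]
  refine Finset.sum_eq_zero fun κ _ => ?_
  rw [mul_smul_comm, map_smul, smul_eq_mul]
  by_cases hκ : ∀ i j, i ≠ j → κ i = 1 ∨ κ j = 1
  · have : f κ = 0 := by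
      rcases eq_one_or_mulSingle hκ with rfl | ⟨i, a, ha, rfl⟩
      exacts [h1, h2 i a ha]
    rw [this, zero_mul]
  · push Not at hκ
    obtain ⟨i, j, hij, hi, hj⟩ := hκ
    have e : S.joint L κ = S.joint L κ * (S.proj i (κ i) * S.proj j (κ j)) := by
      rw [← mul_assoc, ← (proj_commute_joint (i : ℤ × ℤ) (κ i) κ).eq, proj_mul_joint, if_pos rfl,
        ← (proj_commute_joint (j : ℤ × ℤ) (κ j) κ).eq, proj_mul_joint, if_pos rfl]
    rw [e, ← mul_assoc, map_mul_proj_mul_proj_eq_zero hω h (fun e => hij (Subtype.ext e)) hi hj,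
      mul_zero]

/-- A non-trivial total charge of the box is carried by a single site, and the events that it is
carried by the site `i` exclude each other. -/
theorem map_mul_total {χ : A} (hχ : χ ≠ 1) (y : R) :
    ω (y * S.total L χ) = ∑ i ∈ S.region L, ω (y * S.proj i χ) := by
  classical
  have key := map_mul_calculus_eq_zero hω h (L := L)
    (f := (fun κ => if ∏ i, κ i = χ then 1 else 0) -
      ∑ i : S.region L, fun κ => if κ i = χ then 1 else 0) ?_ ?_ y
  · rw [map_sub, map_sum, mul_sub, map_sub, sub_eq_zero, Finset.mul_sum, map_sum] at key
    rw [← Finset.sum_coe_sort (S.region L)]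
    convert key using 2 with i
    · rw [total]
    · rw [← calculus_proj]
  · simp [hχ.symm]
  · intro i a ha
    simp only [Pi.sub_apply, Finset.sum_apply]
    rw [Finset.prod_pi_mulSingle', if_pos (Finset.mem_univ i), Finset.sum_eq_single i]
    · simp
    · intro j _ hj
      rw [Pi.mulSingle_eq_of_ne hj, if_neg hχ.symm]
    · simp

theorem map_mul_proj_mul_total_of_ne {i : ℤ × ℤ} (hi : i ∈ S.region L) {a b : A} (ha : a ≠ 1)
    (hab : a ≠ b) (y : R) : ω (y * (S.proj i a * S.total L b)) = 0 := by
  classical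
  rw [← calculus_proj ⟨i, hi⟩, total, ← map_mul]
  refine map_mul_calculus_eq_zero hω h ?_ ?_ y
  · simp [ha.symm]
  · intro j c hc
    rw [Pi.mul_apply, Finset.prod_pi_mulSingle', if_pos (Finset.mem_univ j)]
    by_cases hj : ⟨i, hi⟩ = j
    · subst hj
      rw [Pi.mulSingle_eq_same]
      by_cases hc : c = a
      · rw [hc, if_neg hab, mul_zero]
      · rw [if_neg hc, zero_mul]
    · rw [Pi.mulSingle_eq_of_ne hj, if_neg ha.symm, zero_mul]

/-- A non-trivial charge in the box is the total charge of the box. -/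
theorem map_mul_proj_mul_total {i : ℤ × ℤ} (hi : i ∈ S.region L) {a : A} (ha : a ≠ 1) (y : R) :
    ω (y * (S.proj i a * S.total L a)) = ω (y * S.proj i a) := by
  classical
  have h1 : ω (y * (S.proj i a * ∑ b, S.total L b)) = ω (y * S.proj i a) := by
    rw [sum_total, mul_one]
  rw [← h1, Finset.mul_sum, Finset.mul_sum, map_sum, Finset.sum_eq_single a]
  · exact fun b _ hb => map_mul_proj_mul_total_of_ne hω h hi ha hb.symm y
  · simp

omit hω h in
theorem total_commute_total (M : ℕ) (χ ξ : A) : Commute (S.total L χ) (S.total M ξ) :=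
  commute_total (fun i a => (commute_total (fun j b => S.commute i j a b) χ).symm) ξ

omit h in
theorem map_total_nonneg (χ : A) : 0 ≤ ω (S.total L χ) :=
  hω.map_projection_nonneg (star_total S L χ) (total_mul_self S L χ)

omit h in
theorem map_proj_nonneg (i : ℤ × ℤ) (a : A) : 0 ≤ ω (S.proj i a) :=
  hω.map_projection_nonneg (S.star_proj i a) (S.proj_mul_self i a)

omit h in
theorem map_total_re_le (χ : A) : (ω (S.total L χ)).re ≤ (ω 1).re := by
  classical
  rw [← sum_total S L, map_sum, Complex.re_sum]
  exact Finset.single_le_sum (f := fun χ => (ω (S.total L χ)).re)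
    (fun ξ _ => (Complex.nonneg_iff.1 (map_total_nonneg hω ξ)).1) (Finset.mem_univ χ)

theorem map_total_mul_total {M : ℕ} (hML : M ≤ L) {χ : A} (hχ : χ ≠ 1) :
    ω (S.total L χ * S.total M χ) = ω (S.total M χ) := by
  have h0 := map_mul_total hω h hχ (L := M) 1
  rw [one_mul] at h0
  rw [map_mul_total hω h hχ, h0]
  refine Finset.sum_congr rfl fun i hi => ?_
  rw [← (commute_total (fun j b => S.commute i j χ b) χ).eq, ← one_mul (S.proj i χ * _),
    map_mul_proj_mul_total hω h (S.region_mono hML hi) hχ]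

theorem monotone_map_total {χ : A} (hχ : χ ≠ 1) : Monotone fun L => (ω (S.total L χ)).re := by
  intro M L hML
  have h0 : ∀ L, ω (S.total L χ) = ∑ i ∈ S.region L, ω (S.proj i χ) := by
    intro L
    simpa using map_mul_total hω h hχ (L := L) 1
  simp only [h0, Complex.re_sum]
  exact Finset.sum_le_sum_of_subset_of_nonneg (S.region_mono hML)
    fun i _ _ => (Complex.nonneg_iff.1 (map_proj_nonneg hω i χ)).1

theorem gnsNorm_total_sub_total (M : ℕ) {χ : A} (hχ : χ ≠ 1) :
    gnsNorm ω (S.total L χ - S.total M χ) =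
      √(dist (ω (S.total L χ)).re (ω (S.total M χ)).re) := by
  wlog hML : M ≤ L generalizing L M
  · rw [dist_comm, ← this L (le_of_not_ge hML), ← gnsNorm_neg, neg_sub]
  rw [gnsNorm, Real.dist_eq, abs_of_nonneg (sub_nonneg.2 (monotone_map_total hω h hχ hML)),
    star_sub, star_total, star_total, sub_mul, mul_sub, mul_sub, total_mul_self, total_mul_self,
    ← (total_commute_total M χ χ).eq]
  simp only [map_sub, map_total_mul_total hω h hML hχ, Complex.sub_re]
  congr 1
  ring

/-- The total charge projections converge in the GNS space. For a non-trivial charge the reason is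
that its probability increases with the box; the projection onto trivial charge is the complement
of the sum of the others. -/
theorem gnsCauchy_total (χ : A) : GNSCauchy ω fun L => S.total L χ := by
  classical
  have h1 : ∀ ξ : A, ξ ≠ 1 → GNSCauchy ω fun L => S.total L ξ := by
    intro ξ hξ
    have hc : CauchySeq fun L => (ω (S.total L ξ)).re :=
      (tendsto_atTop_ciSup (monotone_map_total hω h hξ)
        ⟨(ω 1).re, by rintro _ ⟨L, rfl⟩; exact map_total_re_le hω ξ⟩).cauchySeq
    have h2 := (cauchySeq_iff_tendsto_dist_atTop_0.1 hc).sqrt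
    rw [Real.sqrt_zero] at h2
    exact h2.congr fun p => (gnsNorm_total_sub_total hω h p.2 hξ).symm
  by_cases hχ : χ = 1
  · subst hχ
    have h2 := hω.gnsCauchy_sub (x := fun _ => 1) (by simp [GNSCauchy, gnsNorm])
      (hω.gnsCauchy_sum (Finset.univ.erase (1 : A)) (fun ξ L => S.total L ξ)
        fun ξ hξ => h1 ξ (Finset.ne_of_mem_erase hξ))
    have e : ∀ L, S.total L 1 = 1 - ∑ ξ ∈ Finset.univ.erase 1, S.total L ξ := fun L =>
      eq_sub_of_add_eq (by rw [Finset.add_sum_erase _ _ (Finset.mem_univ _), sum_total])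
    simpa only [← e] using h2
  · exact h1 χ hχ

end AtMostOne

end ChargeSystem

/-! ### Energy and transport of charges -/

namespace ChargeSystem

section Energy

variable {R A : Type*} [NormedRing R] [StarRing R] [NormedAlgebra ℂ R] [StarModule ℂ R]
  [NormedStarGroup R] [Fintype A] [CommGroup A] (S : ChargeSystem R A)

/-- The number of non-trivial charges in the box. -/
noncomputable def energy (L : ℕ) : R := ∑ i ∈ S.region L, (1 - S.proj i 1)

variable {S}

/-- Every configuration has at least as many charges as a charge of the box demands, with equality
on the support of `ω`. Hence a state with at most one charge cannot lose energy to an observable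
that preserves the total charge of the box. -/
theorem map_star_mul_commutator_energy_nonneg {ω : WeakDual ℂ R} (hω : IsPositive ω)
    (h : S.AtMostOne ω) {L : ℕ} {a : R} (ha : Commute a (S.total L 1)) :
    0 ≤ ω (star a * (S.energy L * a - a * S.energy L)) := by
  classical
  -- the number of charges minus the least number that the total charge allows
  let r : (S.region L → A) → ℝ := fun κ =>
    (∑ i, if κ i = 1 then 0 else 1) - if ∏ i, κ i = 1 then 0 else 1
  have hr : ∀ κ, 0 ≤ r κ := by
    intro κ
    by_cases h1 : ∏ i, κ i = 1
    · simp only [r, if_pos h1, sub_zero]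
      exact Finset.sum_nonneg fun i _ => by split_ifs <;> norm_num
    · obtain ⟨i, -, hi⟩ := Finset.exists_ne_one_of_prod_ne_one h1
      have h2 := Finset.single_le_sum (f := fun i => if κ i = 1 then (0 : ℝ) else 1)
        (fun i _ => by split_ifs <;> norm_num) (Finset.mem_univ i)
      simp only [if_neg hi] at h2
      simp only [r, if_neg h1]
      linarith
  have e1 : S.energy L - (1 - S.total L 1) = S.calculus L fun κ => (r κ : ℂ) := by
    have : (fun κ => (r κ : ℂ)) = ∑ i : S.region L, (1 - fun κ => if κ i = 1 then (1 : ℂ) else 0) -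
        (1 - fun κ => if ∏ i, κ i = 1 then (1 : ℂ) else 0) := by
      funext κ
      simp only [r, Pi.sub_apply, Finset.sum_apply, Pi.one_apply]
      push_cast
      congr 1
      · exact Finset.sum_congr rfl fun i _ => by split_ifs <;> simp
      · split_ifs <;> simp
    rw [this, map_sub, map_sub, map_sum, map_one, energy, ← Finset.sum_coe_sort]
    congr 1
    refine Finset.sum_congr rfl fun i _ => ?_
    rw [map_sub, map_one, calculus_proj]
  let q : R := S.calculus L fun κ => (√(r κ) : ℂ)
  have e2 : star q * q = S.calculus L fun κ => (r κ : ℂ) := by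
    rw [← map_star, ← map_mul]
    congr 1
    funext κ
    simp only [Pi.mul_apply, Pi.star_apply, Complex.star_def, Complex.conj_ofReal]
    rw [← Complex.ofReal_mul, Real.mul_self_sqrt (hr κ)]
  have e3 : ω (star a * a * S.calculus L fun κ => (r κ : ℂ)) = 0 := by
    refine map_mul_calculus_eq_zero hω h ?_ ?_ _
    · simp [r]
    · intro i b hb
      rw [Complex.ofReal_eq_zero]
      simp only [r]
      rw [Finset.prod_pi_mulSingle', if_pos (Finset.mem_univ i), if_neg hb, sub_eq_zero,
        Finset.sum_eq_single i]
      · simp [hb]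
      · intro j _ hj
        rw [Pi.mulSingle_eq_of_ne hj, if_pos rfl]
      · simp
  have e4 : star a * (S.energy L * a - a * S.energy L) =
      star (q * a) * (q * a) - star a * a * S.calculus L fun κ => (r κ : ℂ) := by
    have e5 : star (q * a) * (q * a) = star a * (S.energy L - (1 - S.total L 1)) * a := by
      rw [e1, ← e2, star_mul]
      simp only [mul_assoc]
    rw [e5, ← e1]
    have := ha.eq
    simp only [mul_sub, sub_mul, mul_assoc, mul_one, this]
    abel
  rw [e4, map_sub, e3, sub_zero]
  exact hω _

theorem commute_energy {x : R} (h : ∀ i a, Commute x (S.proj i a)) (L : ℕ) :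
    Commute x (S.energy L) :=
  Commute.sum_right _ _ _ fun i _ => (Commute.one_right _).sub_right (h i 1)

end Energy

section Moves

variable {R A B : Type*} [NormedRing R] [StarRing R] [NormedAlgebra ℂ R] [StarModule ℂ R]
  [NormedStarGroup R] [Fintype A] [CommGroup A] [Fintype B] [CommGroup B]

/-- The unitary `u` multiplies the charges of `S` by `s` and leaves those of `T` unchanged: it maps
the states with charge `b` at the site `k` to those with charge `b * s k`. -/
structure Moves (S : ChargeSystem R A) (T : ChargeSystem R B) (u : R) (s : ℤ × ℤ → A) : Prop where
  star_mul_self : star u * u = 1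
  mul_star_self : u * star u = 1
  mul_proj : ∀ k b, u * S.proj k b = S.proj k (b * s k) * u
  commute : ∀ k b, Commute u (T.proj k b)

namespace Moves

variable {S : ChargeSystem R A} {T : ChargeSystem R B} {u v : R} {s t : ℤ × ℤ → A}

theorem one : Moves S T 1 1 := by
  constructor <;> simp

theorem mul (hu : Moves S T u s) (hv : Moves S T v t) : Moves S T (u * v) (s * t) where
  star_mul_self := by
    rw [star_mul, mul_assoc, ← mul_assoc (star u), hu.star_mul_self, one_mul, hv.star_mul_self]
  mul_star_self := by
    rw [star_mul, mul_assoc, ← mul_assoc v, hv.mul_star_self, one_mul, hu.mul_star_self]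
  mul_proj k b := by
    rw [mul_assoc, hv.mul_proj, ← mul_assoc, hu.mul_proj, mul_assoc, Pi.mul_apply, mul_assoc b,
      mul_comm (t k)]
  commute k b := (hu.commute k b).mul_left (hv.commute k b)

theorem star_mul_proj_mul (hu : Moves S T u s) (k : ℤ × ℤ) (b : A) :
    star u * S.proj k b * u = S.proj k (b * (s k)⁻¹) := by
  have := hu.mul_proj k (b * (s k)⁻¹)
  rw [inv_mul_cancel_right] at this
  rw [mul_assoc, ← this, ← mul_assoc, hu.star_mul_self, one_mul]

theorem star (hu : Moves S T u s) : Moves S T (star u) s⁻¹ where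
  star_mul_self := by rw [star_star, hu.mul_star_self]
  mul_star_self := by rw [star_star, hu.star_mul_self]
  mul_proj k b := by
    have := hu.star_mul_proj_mul k b
    rw [Pi.inv_apply, ← this, mul_assoc, hu.mul_star_self, mul_one]
  commute k b := by
    have h1 := (hu.commute k b).eq
    have h2 : Star.star u * (u * T.proj k b) * Star.star u =
        Star.star u * (T.proj k b * u) * Star.star u := by rw [h1]
    rw [← mul_assoc, hu.star_mul_self, one_mul, mul_assoc, mul_assoc, hu.mul_star_self,
      mul_one] at h2
    exact h2.symm

theorem star_mul_mul_commute {x : R} (hu : Moves S T u s) (hx : Commute u x) :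
    Star.star u * x * u = x := by
  rw [mul_assoc, ← hx.eq, ← mul_assoc, hu.star_mul_self, one_mul]

/-- Merging the charge `a` at `i` into the charge `b` at `j` lowers the energy. -/
theorem exists_energy_commutator {i j : ℤ × ℤ} (hij : i ≠ j) {a b : A} (ha : a ≠ 1) (hb : b ≠ 1)
    (hu : Moves S T u (Pi.mulSingle i a⁻¹ * Pi.mulSingle j a)) :
    ∃ n : ℕ, 0 < n ∧ ∀ L, i ∈ S.region L → j ∈ S.region L →
      S.energy L * (u * (S.proj i a * S.proj j b)) - u * (S.proj i a * S.proj j b) * S.energy L =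
        -((n : ℂ) • (u * (S.proj i a * S.proj j b))) := by
  classical
  obtain ⟨q, hq⟩ : ∃ q, q = S.proj i a * S.proj j b := ⟨_, rfl⟩
  rw [← hq]
  have hqc : ∀ k c, Commute (S.proj k c) q := fun k c =>
    hq ▸ (S.commute k i c a).mul_right (S.commute k j c b)
  have key : ∀ k c, S.proj k c * (u * q) = u * (S.proj k (c * ((Pi.mulSingle i a⁻¹ *
      Pi.mulSingle j a : ℤ × ℤ → A) k)⁻¹) * q) := by
    intro k c
    rw [← mul_assoc u (S.proj k _), hu.mul_proj, inv_mul_cancel_right, mul_assoc]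
  have hi : ∀ c, S.proj i c * q = if c = a then q else 0 := by
    intro c
    rw [hq, ← mul_assoc, S.proj_mul_proj]
    split_ifs <;> simp
  have hj : ∀ c, S.proj j c * q = if c = b then q else 0 := by
    intro c
    rw [hq, (S.commute i j a b).eq, ← mul_assoc, S.proj_mul_proj]
    split_ifs <;> simp
  -- the site `i` becomes empty, and so does `j` if the two charges annihilate each other
  refine ⟨if a⁻¹ = b then 2 else 1, by split_ifs <;> norm_num, fun L hiL hjL => ?_⟩
  have h1 : ∀ k, (1 - S.proj k 1) * (u * q) - u * q * (1 - S.proj k 1) =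
      if k = i then -(u * q) else if k = j then -(if a⁻¹ = b then u * q else 0) else 0 := by
    intro k
    rw [sub_mul, mul_sub, one_mul, mul_one, key, mul_assoc, ← (hqc k 1).eq]
    split_ifs with h2 h3 h4
    · subst h2
      rw [Pi.mul_apply, Pi.mulSingle_eq_same, Pi.mulSingle_eq_of_ne hij, hi, hi, if_neg ha.symm]
      simp
    · subst h3
      rw [Pi.mul_apply, Pi.mulSingle_eq_same, Pi.mulSingle_eq_of_ne hij.symm, hj, hj,
        if_neg hb.symm]
      simp [h4]
    · subst h3
      rw [Pi.mul_apply, Pi.mulSingle_eq_same, Pi.mulSingle_eq_of_ne hij.symm, hj, hj,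
        if_neg hb.symm]
      simp [h4]
    · rw [Pi.mul_apply, Pi.mulSingle_eq_of_ne h2, Pi.mulSingle_eq_of_ne h3]
      simp
  rw [energy, Finset.sum_mul, Finset.mul_sum, ← Finset.sum_sub_distrib]
  simp only [h1]
  rw [← Finset.add_sum_erase _ _ hiL, if_pos rfl,
    ← Finset.add_sum_erase _ _ (Finset.mem_erase.2 ⟨hij.symm, hjL⟩), if_neg hij.symm, if_pos rfl,
    Finset.sum_eq_zero]
  · split_ifs
    · rw [Nat.cast_ofNat, two_smul]; abel
    · simp
  · intro k hk
    rw [Finset.mem_erase, Finset.mem_erase] at hk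
    rw [if_neg hk.2.1, if_neg hk.1]

end Moves

end Moves

end ChargeSystem

/-! ### Two commuting species of charges -/

/-- Two commuting charge systems, whose total charges in large boxes commute with every element of
a dense set of local observables. -/
structure ChargePair (R A B : Type*) [NormedRing R] [StarRing R] [NormedAlgebra ℂ R]
    [StarModule ℂ R] [Fintype A] [CommGroup A] [Fintype B] [CommGroup B] where
  /-- The charges of the first species. -/
  fst : ChargeSystem R A
  /-- The charges of the second species. -/
  snd : ChargeSystem R B
  commute : ∀ i j a b, Commute (fst.proj i a) (snd.proj j b)
  /-- The local observables. -/
  loc : Set R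
  dense_loc : Dense loc
  commute_fst : ∀ x ∈ loc, ∀ a, ∀ᶠ L in atTop, Commute x (fst.total L a)
  commute_snd : ∀ x ∈ loc, ∀ b, ∀ᶠ L in atTop, Commute x (snd.total L b)

namespace ChargePair

open ChargeSystem

variable {R A B : Type*} [NormedRing R] [StarRing R] [NormedAlgebra ℂ R] [StarModule ℂ R]
  [NormedStarGroup R] [Fintype A] [CommGroup A] [Fintype B] [CommGroup B]

/-- The same pair with the two species exchanged. -/
def swap (P : ChargePair R A B) : ChargePair R B A where
  fst := P.snd
  snd := P.fst
  commute i j a b := (P.commute j i b a).symm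
  loc := P.loc
  dense_loc := P.dense_loc
  commute_fst := P.commute_snd
  commute_snd := P.commute_fst

/-- The states with at most one charge of either species. -/
def ground (P : ChargePair R A B) : Set (WeakDual ℂ R) :=
  {ω | IsPositive ω ∧ ω 1 = 1 ∧ P.fst.AtMostOne ω ∧ P.snd.AtMostOne ω}

/-- The projection onto total charge `(a, b)` in the box. -/
noncomputable def charge (P : ChargePair R A B) (L : ℕ) (a : A) (b : B) : R :=
  P.fst.total L a * P.snd.total L b

/-- The states with at most one charge of either species that have total charge `(a, b)` in the
limit of large boxes. -/
def sector (P : ChargePair R A B) (a : A) (b : B) : Set (WeakDual ℂ R) :=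
  {ω | ω ∈ P.ground ∧ Tendsto (fun L => ω (P.charge L a b)) atTop (𝓝 1)}

/-- The states with at most one charge of either species, whose charges are in `{1, a}` and
`{1, b}`. -/
def carrier (P : ChargePair R A B) (a : A) (b : B) : Set (WeakDual ℂ R) :=
  {ω | ω ∈ P.ground ∧ (∀ i x, x ≠ 1 → x ≠ a → ω (P.fst.proj i x) = 0) ∧
    ∀ i y, y ≠ 1 → y ≠ b → ω (P.snd.proj i y) = 0}

variable (P : ChargePair R A B) {ω : WeakDual ℂ R} {a : A} {b : B}

theorem total_commute_total (L M : ℕ) (a : A) (b : B) :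
    Commute (P.fst.total L a) (P.snd.total M b) :=
  commute_total (fun j y => (commute_total (fun i x => (P.commute i j x y).symm) a).symm) b

theorem swap_charge (L : ℕ) : P.swap.charge L b a = P.charge L a b :=
  (P.total_commute_total L L a b).eq.symm

theorem swap_ground : P.swap.ground = P.ground := by
  ext ω
  exact ⟨fun h => ⟨h.1, h.2.1, h.2.2.2, h.2.2.1⟩, fun h => ⟨h.1, h.2.1, h.2.2.2, h.2.2.1⟩⟩

theorem swap_sector : P.swap.sector b a = P.sector a b := by
  ext ω
  simp only [sector, swap_ground, swap_charge]

theorem star_charge (L : ℕ) : star (P.charge L a b) = P.charge L a b := by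
  rw [charge, star_mul, star_total, star_total, (P.total_commute_total L L a b).eq]

theorem charge_mul_self (L : ℕ) : P.charge L a b * P.charge L a b = P.charge L a b := by
  rw [charge, (P.total_commute_total L L a b).symm.mul_mul_mul_comm, total_mul_self,
    total_mul_self]

theorem fst_proj_commute_charge (L : ℕ) (i : ℤ × ℤ) (x : A) :
    Commute (P.fst.proj i x) (P.charge L a b) :=
  (commute_total (fun j y => P.fst.commute i j x y) a).mul_right
    (commute_total (fun j y => P.commute i j x y) b)

theorem snd_proj_commute_charge (L : ℕ) (i : ℤ × ℤ) (y : B) :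
    Commute (P.snd.proj i y) (P.charge L a b) :=
  (commute_total (fun j x => (P.commute j i x y).symm) a).mul_right
    (commute_total (fun j x => P.snd.commute i j y x) b)

theorem gnsCauchy_charge (h : ω ∈ P.ground) (a : A) (b : B) :
    GNSCauchy ω fun L => P.charge L a b :=
  h.1.gnsCauchy_mul (gnsCauchy_total h.1 h.2.2.1 a) (gnsCauchy_total h.1 h.2.2.2 b)
    (fun L => star_total _ L a) (fun L => total_mul_self _ L a)
    (fun L => star_total _ L b) (fun L => total_mul_self _ L b)
    fun L M => P.total_commute_total L M a b

theorem gnsNorm_charge_le (h : IsPositive ω) (L : ℕ) :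
    gnsNorm ω (P.charge L a b) ≤ gnsNorm ω 1 := by
  have := h.gnsNorm_projection_mul_le (P.star_charge (a := a) (b := b) L) (P.charge_mul_self L) 1
  rwa [mul_one] at this

/-- The restriction of a state with at most one charge of either species to a given total charge
at infinity. It is positive since the total charge of a large box commutes with a given local
observable. -/
theorem exists_restriction (h : ω ∈ P.ground) (a : A) (b : B) :
    ∃ τ : WeakDual ℂ R, (∀ x, Tendsto (fun L => ω (x * P.charge L a b)) atTop (𝓝 (τ x))) ∧
      IsPositive τ ∧ P.fst.AtMostOne τ ∧ P.snd.AtMostOne τ ∧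
      Tendsto (fun L => τ (P.charge L a b)) atTop (𝓝 (τ 1)) := by
  have hc := P.gnsCauchy_charge h a b
  choose z hz using fun x => h.1.exists_tendsto_map_mul hc x
  obtain ⟨C, hC0, hC⟩ := h.1.exists_norm_map_mul_le
  let τ₀ : R →ₗ[ℂ] ℂ :=
    { toFun := z
      map_add' := fun x y => tendsto_nhds_unique (hz (x + y))
        (((hz x).add (hz y)).congr fun L => by rw [add_mul, map_add])
      map_smul' := fun k x => tendsto_nhds_unique (hz (k • x))
        (((hz x).const_mul k).congr fun L => by rw [smul_mul_assoc, map_smul, smul_eq_mul]) }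
  have hbound : ∀ x, ‖τ₀ x‖ ≤ C * gnsNorm ω 1 * ‖x‖ := by
    intro x
    refine le_of_tendsto (hz x).norm (Eventually.of_forall fun L => (hC _ _).trans ?_)
    rw [mul_right_comm]
    gcongr
    exact P.gnsNorm_charge_le h.1 L
  let τ : WeakDual ℂ R := StrongDual.toWeakDual (τ₀.mkContinuous _ hbound)
  have hτ : ∀ x, Tendsto (fun L => ω (x * P.charge L a b)) atTop (𝓝 (τ x)) := hz
  refine ⟨τ, hτ, ?_, ?_, ?_, ?_⟩
  · have hcont : Continuous fun x : R => τ (star x * x) :=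
      (map_continuous τ).comp (continuous_star.mul continuous_id)
    have hcl : IsClosed {x : R | 0 ≤ τ (star x * x)} :=
      isClosed_le continuous_const hcont
    intro x
    refine closure_minimal ?_ hcl (P.dense_loc x)
    intro y hy
    refine ge_of_tendsto (hτ (star y * y)) ?_
    filter_upwards [P.commute_fst y hy a, P.commute_snd y hy b] with L h1 h2
    have hcomm : Commute y (P.charge L a b) := h1.mul_right h2
    have e : star y * y * P.charge L a b =
        star (y * P.charge L a b) * (y * P.charge L a b) := by
      conv_rhs => rw [hcomm.eq]
      rw [star_mul, P.star_charge, mul_assoc (star y) (P.charge L a b),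
        ← mul_assoc (P.charge L a b), P.charge_mul_self, ← hcomm.eq, mul_assoc]
    rw [e]
    exact h.1 _
  · intro i j x y hij hx hy
    refine tendsto_nhds_unique (hτ _) (tendsto_const_nhds.congr fun L => ?_)
    rw [((P.fst_proj_commute_charge L i x).mul_left (P.fst_proj_commute_charge L j y)).eq,
      map_mul_proj_mul_proj_eq_zero h.1 h.2.2.1 hij hx hy]
  · intro i j x y hij hx hy
    refine tendsto_nhds_unique (hτ _) (tendsto_const_nhds.congr fun L => ?_)
    rw [((P.snd_proj_commute_charge L i x).mul_left (P.snd_proj_commute_charge L j y)).eq,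
      map_mul_proj_mul_proj_eq_zero h.1 h.2.2.2 hij hx hy]
  -- `ω (D_M D_L)` is close to `ω (D_M)` when `L` and `M` are large; let `L`, then `M` tend to `∞`
  · have h1 := hτ 1
    simp only [one_mul] at h1
    have h2 : Tendsto (fun M => τ (P.charge M a b) - ω (P.charge M a b)) atTop (𝓝 0) := by
      rw [Metric.tendsto_atTop]
      intro ε hε
      have h3 := hc.const_mul (gnsNorm ω 1)
      rw [mul_zero] at h3
      obtain ⟨N, hN⟩ := Metric.tendsto_atTop.1 h3 (ε / 2) (half_pos hε)
      refine ⟨max N.1 N.2, fun M hM => ?_⟩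
      rw [dist_zero_right]
      refine lt_of_le_of_lt ?_ (half_lt_self hε)
      refine le_of_tendsto ((hτ (P.charge M a b)).sub_const (ω (P.charge M a b))).norm ?_
      filter_upwards [eventually_ge_atTop N.1] with L hL
      have h4 := hN (L, M) ⟨hL, (le_max_right _ _).trans hM⟩
      rw [dist_zero_right, Real.norm_of_nonneg
        (mul_nonneg (gnsNorm_nonneg _ _) (gnsNorm_nonneg _ _))] at h4
      have e : P.charge M a b * P.charge L a b - P.charge M a b =
          star (P.charge M a b) * (P.charge L a b - P.charge M a b) := by
        rw [mul_sub, P.star_charge, P.charge_mul_self]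
      rw [← map_sub, e]
      refine (h.1.norm_map_star_mul_le _ _).trans (le_trans ?_ h4.le)
      exact mul_le_mul_of_nonneg_right (P.gnsNorm_charge_le h.1 M) (gnsNorm_nonneg _ _)
    simpa using h2.add h1

/-- In a sector, the charge projections tend to the identity in the GNS space. -/
theorem tendsto_map_mul_charge (h : ω ∈ P.sector a b) (x : R) :
    Tendsto (fun L => ω (x * P.charge L a b)) atTop (𝓝 (ω x)) := by
  obtain ⟨C, hC0, hC⟩ := h.1.1.exists_norm_map_mul_le
  rw [tendsto_iff_norm_sub_tendsto_zero]
  have h1 : Tendsto (fun L => C * ‖x‖ * √(1 - ω (P.charge L a b)).re) atTop (𝓝 0) := by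
    have h2 := (Complex.continuous_re.tendsto _).comp (h.2.const_sub 1)
    rw [sub_self, Complex.zero_re] at h2
    have h3 := (h2.sqrt).const_mul (C * ‖x‖)
    rw [Real.sqrt_zero, mul_zero] at h3
    exact h3
  refine squeeze_zero (fun _ => norm_nonneg _) (fun L => ?_) h1
  rw [norm_sub_rev, ← map_sub]
  have e : x - x * P.charge L a b = x * (1 - P.charge L a b) := by rw [mul_sub, mul_one]
  rw [e]
  refine (hC _ _).trans_eq ?_
  rw [gnsNorm, star_sub, star_one, P.star_charge, sub_mul, one_mul, mul_sub, mul_one,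
    P.charge_mul_self, sub_self, sub_zero, map_sub, h.1.2.1]

/-- The conditional states of total charge `(a, b)` are the states of the sector `(a, b)`. -/
theorem mem_sector_iff {φ : WeakDual ℂ R} : φ ∈ P.sector a b ↔
    (IsPositive φ ∧ φ 1 = 1) ∧ ∃ ω ∈ P.ground,
      (∃ l : ℝ, 0 < l ∧ Tendsto (fun L => ω (P.charge L a b)) atTop (𝓝 (l : ℂ))) ∧
      ∀ x, Tendsto (fun L => ω (x * P.charge L a b) / ω (P.charge L a b)) atTop (𝓝 (φ x)) := by
  constructor
  · intro h
    refine ⟨⟨h.1.1, h.1.2.1⟩, φ, h.1, ⟨1, one_pos, by simpa using h.2⟩, fun x => ?_⟩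
    have := (P.tendsto_map_mul_charge h x).div h.2 one_ne_zero
    rwa [div_one] at this
  · rintro ⟨⟨h1, h2⟩, ω, hω, ⟨l, hl, hlim⟩, hφ⟩
    obtain ⟨τ, hτ, -, hf, hs, ht⟩ := P.exists_restriction hω a b
    have hl0 : (l : ℂ) ≠ 0 := Complex.ofReal_ne_zero.2 hl.ne'
    have e : ∀ x, φ x = τ x / l := fun x =>
      tendsto_nhds_unique (hφ x) ((hτ x).div hlim hl0)
    have hl1 : τ 1 = l := tendsto_nhds_unique (hτ 1) (by simpa using hlim)
    refine ⟨⟨h1, h2, fun i j x y hij hx hy => ?_, fun i j x y hij hx hy => ?_⟩, ?_⟩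
    · rw [e, hf i j x y hij hx hy, zero_div]
    · rw [e, hs i j x y hij hx hy, zero_div]
    · have := ht.div_const (l : ℂ)
      rw [hl1, div_self hl0] at this
      simpa only [e] using this

theorem convex_sector (a : A) (b : B) : Convex ℝ (P.sector a b) := by
  rintro φ hφ ψ hψ s t hs ht hst
  have e : ∀ x, (s • φ + t • ψ) x = (s : ℂ) * φ x + (t : ℂ) * ψ x := by
    intro x
    rw [← Complex.real_smul, ← Complex.real_smul]
    rfl
  have hst' : (s : ℂ) + t = 1 := by exact_mod_cast hst
  refine ⟨⟨fun x => ?_, ?_, fun i j x y hij hx hy => ?_, fun i j x y hij hx hy => ?_⟩, ?_⟩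
  · rw [e]
    exact add_nonneg (mul_nonneg (Complex.zero_le_real.2 hs) (hφ.1.1 x))
      (mul_nonneg (Complex.zero_le_real.2 ht) (hψ.1.1 x))
  · rw [e, hφ.1.2.1, hψ.1.2.1, mul_one, mul_one, hst']
  · rw [e, hφ.1.2.2.1 i j x y hij hx hy, hψ.1.2.2.1 i j x y hij hx hy]; simp
  · rw [e, hφ.1.2.2.2 i j x y hij hx hy, hψ.1.2.2.2 i j x y hij hx hy]; simp
  · have := (hφ.2.const_mul (s : ℂ)).add (hψ.2.const_mul (t : ℂ))
    simpa only [e, mul_one, hst'] using this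

theorem isClosed_carrier (a : A) (b : B) : IsClosed (P.carrier a b) := by
  have hev : ∀ x : R, Continuous fun ω : WeakDual ℂ R => ω x := WeakDual.eval_continuous
  have hz : ∀ x : R, IsClosed {ω : WeakDual ℂ R | ω x = 0} := fun x =>
    isClosed_eq (hev x) continuous_const
  simp only [carrier, ground, IsPositive, AtMostOne, Set.ofPred_and,
    Set.ofPred_forall]
  refine ((isClosed_iInter fun x => ?_).inter (IsClosed.inter ?_ (IsClosed.inter ?_ ?_))).inter
    (IsClosed.inter ?_ ?_)
  · exact isClosed_le continuous_const (hev _)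
  · exact isClosed_eq (hev 1) continuous_const
  all_goals repeat' (refine isClosed_iInter fun _ => ?_)
  all_goals exact hz _

theorem sector_subset_carrier (a : A) (b : B) : P.sector a b ⊆ P.carrier a b := by
  intro φ h
  refine ⟨h.1, fun i x hx hxa => ?_, fun i y hy hyb => ?_⟩
  · refine tendsto_nhds_unique (P.tendsto_map_mul_charge h _) (tendsto_const_nhds.congr' ?_)
    filter_upwards [P.fst.eventually_mem_region i] with L hL
    have hc : Commute (P.snd.total L b) (P.fst.proj i x * P.fst.total L a) :=
      (commute_total (fun j y => P.commute i j x y) b).symm.mul_right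
        (P.total_commute_total L L a b).symm
    rw [charge, ← mul_assoc, ← hc.eq]
    exact (map_mul_proj_mul_total_of_ne h.1.1 h.1.2.2.1 hL hx hxa _).symm
  · refine tendsto_nhds_unique (P.tendsto_map_mul_charge h _) (tendsto_const_nhds.congr' ?_)
    filter_upwards [P.snd.eventually_mem_region i] with L hL
    have hc : Commute (P.snd.proj i y) (P.fst.total L a) :=
      commute_total (fun j x => (P.commute j i x y).symm) a
    rw [charge, ← mul_assoc, hc.eq, mul_assoc]
    exact (map_mul_proj_mul_total_of_ne h.1.1 h.1.2.2.2 hL hy hyb _).symm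

/-- If the charges of a state are in `{1, a}`, so is the total charge of every box. -/
theorem sum_map_mul_fst_total [DecidableEq A] (h : ω ∈ P.carrier a b) (L : ℕ) (y : R) :
    ∑ x ∈ {1, a}, ω (y * P.fst.total L x) = ω y := by
  have h0 : ∑ x, ω (y * P.fst.total L x) = ω y := by
    rw [← map_sum, ← Finset.mul_sum, sum_total, mul_one]
  rw [← h0]
  refine Finset.sum_subset (Finset.subset_univ _) fun x _ hx => ?_
  rw [Finset.mem_insert, Finset.mem_singleton, not_or] at hx
  refine h.1.1.map_mul_eq_zero ?_ y
  have h1 := map_mul_total h.1.1 h.1.2.2.1 hx.1 (L := L) 1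
  simp only [one_mul] at h1
  rw [star_total, total_mul_self, h1]
  exact Finset.sum_eq_zero fun i _ => h.2.1 i x hx.1 hx.2

theorem swap_carrier : P.swap.carrier b a = P.carrier a b := by
  ext ω
  simp only [carrier, swap_ground]
  exact ⟨fun h => ⟨h.1, h.2.2, h.2.1⟩, fun h => ⟨h.1, h.2.2, h.2.1⟩⟩

theorem sum_map_mul_snd_total [DecidableEq B] (h : ω ∈ P.carrier a b) (L : ℕ) (y : R) :
    ∑ x ∈ {1, b}, ω (y * P.snd.total L x) = ω y :=
  P.swap.sum_map_mul_fst_total (P.swap_carrier.symm ▸ h) L y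

theorem sum_map_mul_charge [DecidableEq A] [DecidableEq B] (h : ω ∈ P.carrier a b) (L : ℕ)
    (y : R) : ∑ p ∈ ({1, a} : Finset A) ×ˢ ({1, b} : Finset B), ω (y * P.charge L p.1 p.2) =
      ω y := by
  rw [Finset.sum_product, ← P.sum_map_mul_fst_total h L y]
  refine Finset.sum_congr rfl fun x _ => ?_
  simp only [charge, ← mul_assoc]
  exact P.sum_map_mul_snd_total h L _

/-- A state without charges has total charge `(1, 1)` in every box, and conversely. -/
theorem mem_sector_one_one_iff :
    ω ∈ P.sector 1 1 ↔ ω ∈ P.carrier 1 1 := by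
  classical
  refine ⟨fun h => P.sector_subset_carrier 1 1 h, fun h => ⟨h.1, ?_⟩⟩
  refine tendsto_const_nhds.congr fun L => ?_
  have := P.sum_map_mul_charge h L 1
  simpa [h.1.2.1] using this.symm

/-- A state with charges in `{1, a}` and `{1, b}` is a mixture of its restrictions to the four
possible total charges. -/
theorem carrier_subset_convexHull (a : A) (b : B) : P.carrier a b ⊆
    convexHull ℝ (P.sector 1 1 ∪ P.sector a 1 ∪ P.sector 1 b ∪ P.sector a b) := by
  classical
  intro φ h
  choose τ hτ hpos hf hs ht using fun p : A × B => P.exists_restriction h.1 p.1 p.2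
  let s : Finset (A × B) := ({1, a} : Finset A) ×ˢ ({1, b} : Finset B)
  have hsum : ∀ x, ∑ p ∈ s, τ p x = φ x := fun x =>
    tendsto_nhds_unique (tendsto_finsetSum s fun p _ => hτ p x)
      (tendsto_const_nhds.congr fun L => (P.sum_map_mul_charge h L x).symm)
  let w : A × B → ℝ := fun p => (τ p 1).re
  have hw0 : ∀ p, 0 ≤ τ p 1 := fun p => by simpa using hpos p 1
  have hw : ∀ p, τ p 1 = (w p : ℂ) := fun p =>
    Complex.ext rfl (Complex.nonneg_iff.1 (hw0 p)).2.symm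
  -- a positive functional that vanishes at the unit vanishes
  have hzero : ∀ p, w p = 0 → ∀ x, τ p x = 0 := fun p hp x => by
    have := (hpos p).map_mul_eq_zero (x := 1) (by simp [hw, hp]) x
    rwa [mul_one] at this
  let z : A × B → WeakDual ℂ R := fun p => (w p)⁻¹ • τ p
  have hz : ∀ p x, z p x = τ p x / w p := fun p x => by
    change (w p)⁻¹ • τ p x = _
    rw [Complex.real_smul, Complex.ofReal_inv, div_eq_inv_mul]
  have hφ : φ = ∑ p ∈ s.filter (fun p => w p ≠ 0), w p • z p := by
    refine DFunLike.ext _ _ fun x => ?_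
    let ev : WeakDual ℂ R →+ ℂ := ⟨⟨fun ψ => ψ x, rfl⟩, fun _ _ => rfl⟩
    change ev φ = ev _
    rw [map_sum, Finset.sum_filter]
    refine (hsum x).symm.trans ?_
    refine Finset.sum_congr rfl fun p _ => ?_
    split_ifs with hp
    · change _ = w p • z p x
      rw [hz, Complex.real_smul, mul_div_cancel₀ _ (Complex.ofReal_ne_zero.2 hp)]
    · exact hzero p (not_not.1 hp) x
  rw [hφ]
  refine (convex_convexHull ℝ _).sum_mem (fun p _ => (Complex.nonneg_iff.1 (hw0 p)).1) ?_ ?_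
  · rw [Finset.sum_filter_ne_zero]
    have := hsum 1
    rw [h.1.2.1] at this
    simp only [hw] at this
    exact_mod_cast this
  · intro p hp
    obtain ⟨hps, hp⟩ := Finset.mem_filter.1 hp
    have hp0 : (w p : ℂ) ≠ 0 := Complex.ofReal_ne_zero.2 hp
    have hmem : z p ∈ P.sector p.1 p.2 := by
      refine ⟨⟨fun x => ?_, ?_, fun i j x y hij hx hy => ?_, fun i j x y hij hx hy => ?_⟩, ?_⟩
      · rw [hz]
        exact div_nonneg (hpos p x) (hw p ▸ hw0 p)
      · rw [hz, hw, div_self hp0]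
      · rw [hz, hf p i j x y hij hx hy, zero_div]
      · rw [hz, hs p i j x y hij hx hy, zero_div]
      · have := (ht p).div_const (w p : ℂ)
        rw [hw, div_self hp0] at this
        simpa only [hz] using this
    refine subset_convexHull ℝ _ ?_
    obtain ⟨h1, h2⟩ := Finset.mem_product.1 hps
    rw [Finset.mem_insert, Finset.mem_singleton] at h1 h2
    obtain ⟨x, y⟩ := p
    rcases h1 with rfl | rfl <;> rcases h2 with rfl | rfl <;> simp only [Set.mem_union] <;> tauto

end ChargePair

/-! ### Charges brought in from infinity -/

namespace ChargePair

open ChargeSystem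

variable {R A B : Type*} [NormedRing R] [StarRing R] [NormedAlgebra ℂ R] [StarModule ℂ R]
  [CStarRing R] [Fintype A] [CommGroup A] [Fintype B] [CommGroup B]

/-- The charges of the first species can be moved along the ray `(0, 0), (1, 0), …` by unitaries
that leave the charges of the second species unchanged and that eventually commute with any given
local observable. -/
def Mobile (P : ChargePair R A B) : Prop :=
  ∀ a : A, ∃ u : ℕ → R,
    (∀ k : ℕ, Moves P.fst P.snd (u k)
      (Pi.mulSingle ((k : ℤ), 0) a⁻¹ * Pi.mulSingle ((k + 1 : ℤ), 0) a)) ∧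
    ∀ x ∈ P.loc, ∀ᶠ k in atTop, Commute (u k) x

/-- The product `u n * u (n + 1) * ⋯ * u (n + m - 1)`. -/
def hopString (u : ℕ → R) (n : ℕ) : ℕ → R
  | 0 => 1
  | m + 1 => hopString u n m * u (n + m)

theorem hopString_commute {u : ℕ → R} {x : R} {n : ℕ} (h : ∀ k, n ≤ k → Commute (u k) x)
    (m : ℕ) : Commute (hopString u n m) x := by
  induction m with
  | zero => exact Commute.one_left x
  | succ m ih => exact ih.mul_left (h _ (Nat.le_add_right n m))

theorem moves_hopString {S : ChargeSystem R A} {T : ChargeSystem R B} {u : ℕ → R} {a : A}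
    (h : ∀ k : ℕ, Moves S T (u k)
      (Pi.mulSingle ((k : ℤ), 0) a⁻¹ * Pi.mulSingle ((k + 1 : ℤ), 0) a)) (n m : ℕ) :
    Moves S T (hopString u n m)
      (Pi.mulSingle ((n : ℤ), 0) a⁻¹ * Pi.mulSingle ((n + m : ℤ), 0) a) := by
  induction m with
  | zero =>
    have e : (Pi.mulSingle ((n : ℤ), 0) a⁻¹ * Pi.mulSingle ((n + (0 : ℕ) : ℤ), 0) a :
        ℤ × ℤ → A) = 1 := by
      rw [Nat.cast_zero, add_zero, ← Pi.mulSingle_mul, inv_mul_cancel, Pi.mulSingle_one]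
    rw [e]
    exact Moves.one
  | succ m ih =>
    have e : (Pi.mulSingle ((n : ℤ), 0) a⁻¹ * Pi.mulSingle ((n + (m + 1 : ℕ) : ℤ), 0) a :
        ℤ × ℤ → A) = Pi.mulSingle ((n : ℤ), 0) a⁻¹ * Pi.mulSingle ((n + m : ℤ), 0) a *
          (Pi.mulSingle (((n + m : ℕ) : ℤ), 0) a⁻¹ *
            Pi.mulSingle (((n + m : ℕ) + 1 : ℤ), 0) a) := by
      push_cast
      simp only [Pi.mulSingle_inv, mul_assoc, mul_inv_cancel_left, add_assoc]
    rw [e]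
    exact ih.mul (h (n + m))

/-- The functional `x ↦ φ (u* x u)`. -/
noncomputable def conjugate (φ : WeakDual ℂ R) (u : R) : WeakDual ℂ R :=
  ⟨(φ : R →ₗ[ℂ] ℂ) ∘ₗ LinearMap.mulRight ℂ u ∘ₗ LinearMap.mulLeft ℂ (star u), by
    change Continuous fun x => φ (star u * x * u)
    exact (map_continuous φ).comp (by fun_prop)⟩

theorem norm_conjugate_le (φ : WeakDual ℂ R) {u : R} (hu : star u * u = 1) :
    ‖WeakDual.toStrongDual (conjugate φ u)‖ ≤ ‖WeakDual.toStrongDual φ‖ * ‖(1 : R)‖ := by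
  refine ContinuousLinearMap.opNorm_le_bound _ (by positivity) fun x => ?_
  change ‖φ (star u * x * u)‖ ≤ _
  refine ((WeakDual.toStrongDual φ).le_opNorm _).trans
    ((mul_le_mul_of_nonneg_left ?_ (norm_nonneg _)).trans_eq (mul_assoc _ _ _).symm)
  calc ‖star u * x * u‖ ≤ ‖star u‖ * ‖x‖ * ‖u‖ :=
        (norm_mul_le _ _).trans (by gcongr; exact norm_mul_le _ _)
    _ = ‖star u * u‖ * ‖x‖ := by rw [CStarRing.norm_star_mul_self, norm_star]; ring
    _ = ‖(1 : R)‖ * ‖x‖ := by rw [hu]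

variable (P : ChargePair R A B) {a : A} {b : B}

/-- A state without charges of the first species is a limit of states with one charge `a`, that
has been moved from infinity to the site `(n, 0)`. -/
theorem sector_one_subset_closure (hP : P.Mobile) (ha : a ≠ 1) (b : B) :
    P.sector 1 b ⊆ closure (P.sector a b) := by
  classical
  intro φ hφ
  -- moving `a⁻¹` outward along the ray is moving `a` inward
  obtain ⟨u, hu, hloc⟩ := hP a⁻¹
  have hcar := P.sector_subset_carrier 1 b hφ
  have hpos := hφ.1.1
  -- `φ` has no charges of the first species
  have hnull : ∀ i x, x ≠ 1 → ∀ y, φ (y * P.fst.proj i x) = 0 := fun i x hx y =>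
    hpos.map_mul_eq_zero (by rw [P.fst.star_proj, P.fst.proj_mul_self, hcar.2.1 i x hx hx]) y
  let v : ℕ → ℕ → R := hopString u
  have hv : ∀ n m, Moves P.fst P.snd (v n m)
      (Pi.mulSingle ((n : ℤ), 0) a * Pi.mulSingle ((n + m : ℤ), 0) a⁻¹) := fun n m => by
    simpa only [inv_inv] using moves_hopString hu n m
  let r := ‖WeakDual.toStrongDual φ‖ * ‖(1 : R)‖
  have hball : ∀ n m, conjugate φ (v n m) ∈
      WeakDual.toStrongDual ⁻¹' Metric.closedBall (0 : StrongDual ℂ R) r := fun n m => by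
    rw [Set.mem_preimage, mem_closedBall_zero_iff]
    exact norm_conjugate_le φ (hv n m).star_mul_self
  -- for each `n`, a limit point of the states in which the charge comes from `(n + m, 0)`
  have hlim : ∀ n, ∃ ψ ∈ WeakDual.toStrongDual ⁻¹' Metric.closedBall (0 : StrongDual ℂ R) r,
      Tendsto (fun m => conjugate φ (v n m)) (hyperfilter ℕ) (𝓝 ψ) := fun n =>
    (WeakDual.isCompact_closedBall (0 : StrongDual ℂ R) r).ultrafilter_le_nhds
      ((hyperfilter ℕ).map fun m => conjugate φ (v n m))
      (le_principal_iff.2 (mem_map.2 (univ_mem' (hball n))))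
  choose ψ hψr hψ using hlim
  have hat : (hyperfilter ℕ : Filter ℕ) ≤ atTop := Nat.hyperfilter_le_atTop
  have hev : ∀ n x, Tendsto (fun m => φ (star (v n m) * x * v n m)) (hyperfilter ℕ)
      (𝓝 (ψ n x)) := fun n x => ((WeakDual.eval_continuous x).tendsto _).comp (hψ n)
  have heq : ∀ n x z, (∀ᶠ m in atTop, φ (star (v n m) * x * v n m) = z) → ψ n x = z :=
    fun n x z h => tendsto_nhds_unique (hev n x)
      (tendsto_const_nhds.congr' ((h.filter_mono hat).mono fun _ h => h.symm))
  have hψpos : ∀ n, IsPositive (ψ n) := fun n x =>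
    ge_of_tendsto (hev n (star x * x)) (Eventually.of_forall fun m => by
      have := hpos (x * v n m)
      rwa [star_mul, mul_assoc, ← mul_assoc (star x), ← mul_assoc] at this)
  have hcomm : ∀ n x, (∀ m, Commute (v n m) x) → ψ n x = φ x := fun n x h =>
    heq n x _ (Eventually.of_forall fun m => by rw [(hv n m).star_mul_mul_commute (h m)])
  have hmul : ∀ n m x y, star (v n m) * (x * y) * v n m =
      star (v n m) * x * v n m * (star (v n m) * y * v n m) := fun n m x y => by
    simp only [mul_assoc]
    rw [← mul_assoc (v n m) (star (v n m)), (hv n m).mul_star_self, one_mul]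
  -- away from `(n, 0)`, the string does not change the charge of a site
  have hfar : ∀ (n : ℕ) (i : ℤ × ℤ) (x : A), i ≠ ((n : ℤ), (0 : ℤ)) →
      ∀ᶠ m in atTop, star (v n m) * P.fst.proj i x * v n m = P.fst.proj i x := by
    intro n i x hi
    filter_upwards [eventually_gt_atTop (i.1 - n).toNat] with m hm
    rw [(hv n m).star_mul_proj_mul, Pi.mul_apply, Pi.mulSingle_eq_of_ne hi,
      Pi.mulSingle_eq_of_ne, mul_one, inv_one, mul_one]
    rintro rfl
    simp at hm
  -- the string creates the charge `a` at `(n, 0)`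
  have hnear : ∀ n : ℕ, ∀ᶠ m in atTop, star (v n m) * P.fst.proj ((n : ℤ), 0) a * v n m =
      P.fst.proj ((n : ℤ), 0) 1 := by
    intro n
    filter_upwards [eventually_gt_atTop 0] with m hm
    rw [(hv n m).star_mul_proj_mul, Pi.mul_apply, Pi.mulSingle_eq_same, Pi.mulSingle_eq_of_ne,
      mul_one, mul_inv_cancel]
    simp [hm.ne']
  have hone : ∀ i, φ (P.fst.proj i 1) = 1 := by
    intro i
    have := P.fst.sum_proj i
    rw [← Finset.add_sum_erase _ _ (Finset.mem_univ 1)] at this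
    rw [← hφ.1.2.1, ← this, map_add, map_sum, Finset.sum_eq_zero, add_zero]
    exact fun x hx => hcar.2.1 i x (Finset.ne_of_mem_erase hx) (Finset.ne_of_mem_erase hx)
  have hψone : ∀ n, ψ n 1 = 1 := fun n => by
    rw [hcomm n 1 fun m => Commute.one_right _, hφ.1.2.1]
  have hψfst : ∀ n, P.fst.AtMostOne (ψ n) := by
    intro n i j x y hij hx hy
    by_cases hj : j = ((n : ℤ), (0 : ℤ))
    · have hi : i ≠ ((n : ℤ), (0 : ℤ)) := fun h => hij (h.trans hj.symm)
      rw [(P.fst.commute i j x y).eq]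
      refine heq n _ _ ((hfar n i x hi).mono fun m hm => ?_)
      rw [hmul, hm, hnull i x hx]
    · refine heq n _ _ ((hfar n j y hj).mono fun m hm => ?_)
      rw [hmul, hm, hnull j y hy]
  have hψsnd : ∀ n, P.snd.AtMostOne (ψ n) := fun n i j x y hij hx hy => by
    rw [hcomm n _ fun m => ((hv n m).commute i x).mul_right ((hv n m).commute j y)]
    exact hφ.1.2.2.2 i j x y hij hx hy
  have hψsector : ∀ n, ψ n ∈ P.sector a b := by
    intro n
    refine ⟨⟨hψpos n, hψone n, hψfst n, hψsnd n⟩, ?_⟩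
    have h1 : ψ n (P.fst.proj ((n : ℤ), 0) a) = 1 :=
      heq n _ _ ((hnear n).mono fun m hm => by rw [hm, hone])
    -- the charge `a` at `(n, 0)` is certain
    have h2 : ∀ y, ψ n (y * P.fst.proj ((n : ℤ), 0) a) = ψ n y := fun y => by
      have := (hψpos n).map_mul_eq_zero (x := 1 - P.fst.proj ((n : ℤ), 0) a)
        (by rw [star_sub, star_one, P.fst.star_proj, sub_mul, one_mul, mul_sub, mul_one,
          P.fst.proj_mul_self, sub_self, sub_zero, map_sub, h1, hψone, sub_self]) y
      rw [mul_sub, mul_one, map_sub, sub_eq_zero] at this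
      exact this.symm
    refine hφ.2.congr' ?_
    filter_upwards [P.fst.eventually_mem_region ((n : ℤ), 0)] with L hL
    have h3 : φ (P.charge L 1 b) = φ (P.snd.total L b) := by
      have := P.sum_map_mul_fst_total hcar L (P.snd.total L b)
      rw [Finset.pair_eq_singleton, Finset.sum_singleton] at this
      rw [charge, (P.total_commute_total L L 1 b).eq, this]
    have h4 : Commute (P.fst.total L a) (P.fst.proj ((n : ℤ), 0) a) :=
      (commute_total (fun j y => P.fst.commute _ j a y) a).symm
    rw [h3, charge, (P.total_commute_total L L a b).eq, ← h2, mul_assoc, h4.eq,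
      map_mul_proj_mul_total (hψpos n) (hψfst n) hL ha, h2,
      hcomm n _ fun m => commute_total (fun j y => (hv n m).commute j y) b]
  -- the norms of the `ψ n` are bounded, so it suffices to test convergence on local observables
  have hr : ∀ n x, ‖ψ n x‖ ≤ r * ‖x‖ := fun n x => by
    have h1 := hψr n
    rw [Set.mem_preimage, mem_closedBall_zero_iff] at h1
    exact ((WeakDual.toStrongDual (ψ n)).le_opNorm x).trans (by gcongr)
  refine mem_closure_of_tendsto (f := ψ) (b := atTop) ?_ (Eventually.of_forall hψsector)
  rw [tendsto_iff_forall_eval_tendsto_topDualPairing]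
  intro x
  change Tendsto (fun n => ψ n x) atTop (𝓝 (φ x))
  rw [Metric.tendsto_atTop]
  intro ε hε
  obtain ⟨C, hC0, hC⟩ : ∃ C : ℝ, 0 < C ∧ ∀ n z, ‖ψ n z - φ z‖ ≤ C * ‖z‖ := by
    refine ⟨r + ‖WeakDual.toStrongDual φ‖ + 1, by positivity, fun n z => ?_⟩
    refine (norm_sub_le _ _).trans ((add_le_add (hr n z)
      ((WeakDual.toStrongDual φ).le_opNorm z)).trans ?_)
    rw [add_mul, add_mul, one_mul]
    linarith [norm_nonneg z]
  obtain ⟨y, hy, hxy⟩ := P.dense_loc.exists_dist_lt x (div_pos hε hC0)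
  obtain ⟨N, hN⟩ := eventually_atTop.1 (hloc y hy)
  refine ⟨N, fun n hn => ?_⟩
  have h1 : ψ n y = φ y :=
    hcomm n y fun m => hopString_commute (fun k hk => hN k (hn.trans hk)) m
  have h2 : ψ n x - φ x = ψ n (x - y) - φ (x - y) := by rw [map_sub, map_sub, h1]; abel
  rw [dist_eq_norm, h2]
  refine (hC n _).trans_lt ?_
  rw [← dist_eq_norm]
  rwa [lt_div_iff₀' hC0] at hxy

theorem closure_sector (h1 : P.Mobile) (h2 : P.swap.Mobile) (a : A) (b : B) :
    closure (P.sector a b) =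
      convexHull ℝ (P.sector 1 1 ∪ P.sector a 1 ∪ P.sector 1 b ∪ P.sector a b) := by
  have hconv : Convex ℝ (closure (P.sector a b)) := by
    intro φ hφ ψ hψ s t hs ht hst
    refine map_mem_closure₂ (f := fun φ ψ : WeakDual ℂ R => s • φ + t • ψ) ?_ hφ hψ
      fun φ hφ ψ hψ => P.convex_sector a b hφ hψ hs ht hst
    exact ((continuous_const_smul (s : ℂ)).comp continuous_fst).add
      ((continuous_const_smul (t : ℂ)).comp continuous_snd)
  have hfst : ∀ y, P.sector 1 y ⊆ closure (P.sector a y) := fun y => by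
    rcases eq_or_ne a 1 with rfl | ha
    exacts [subset_closure, P.sector_one_subset_closure h1 ha y]
  have hsnd : ∀ x, P.sector x 1 ⊆ closure (P.sector x b) := fun x => by
    rcases eq_or_ne b 1 with rfl | hb
    · exact subset_closure
    · rw [← P.swap_sector, ← P.swap_sector]
      exact P.swap.sector_one_subset_closure h2 hb x
  refine Set.Subset.antisymm ?_ (convexHull_min ?_ hconv)
  · exact (closure_minimal (P.sector_subset_carrier a b) (P.isClosed_carrier a b)).trans
      (P.carrier_subset_convexHull a b)
  · refine Set.union_subset (Set.union_subset (Set.union_subset ?_ (hsnd a)) (hfst b))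
      subset_closure
    exact (hsnd 1).trans (closure_minimal (hfst b) isClosed_closure)

end ChargePair

section QuantumDouble

variable {G : Type*} [CommGroup G] [Fintype G] [DecidableEq G]

/-! ### Diagonal operators and shifts -/

theorem quasiLocal_ext {a b : quasiLocal G}
    (h : ∀ (ψ : Hilb G) (c : Bond → G), (a : Hilb G →L[ℂ] Hilb G) ψ c =
      (b : Hilb G →L[ℂ] Hilb G) ψ c) : a = b := by
  apply Subtype.ext
  ext ψ c
  exact h ψ c

/-- The linear functional `a ↦ (a ψ)(c)`. -/
noncomputable def coeff (ψ : Hilb G) (c : Bond → G) : quasiLocal G →ₗ[ℂ] ℂ where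
  toFun a := (a : Hilb G →L[ℂ] Hilb G) ψ c
  map_add' _ _ := rfl
  map_smul' _ _ := rfl

theorem star_obs (Λ : Finset Bond) (M : Matrix (Λ → G) (Λ → G) ℂ) :
    star (obs Λ M) = obs Λ (star M) :=
  Subtype.ext (map_star (embed Λ) M).symm

/-- The diagonal operator on `Λ` with the given eigenvalues. -/
noncomputable def diagonalObs (Λ : Finset Bond) (d : (Λ → G) → ℂ) : quasiLocal G :=
  obs Λ (Matrix.diagonal d)

/-- The operator `|a⟩ ↦ |t a⟩` on `Λ`. -/
noncomputable def shiftObs (Λ : Finset Bond) (t : Λ → G) : quasiLocal G :=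
  obs Λ (Matrix.of fun a b => if a = t * b then 1 else 0)

theorem diagonalObs_apply (Λ : Finset Bond) (d : (Λ → G) → ℂ) (ψ : Hilb G) (c : Bond → G) :
    (diagonalObs Λ d : Hilb G →L[ℂ] Hilb G) ψ c = d (res Λ c) * ψ c := by
  change embed Λ _ ψ c = _
  rw [embed_apply]
  simp [Matrix.diagonal_apply]

theorem shiftObs_apply (Λ : Finset Bond) (t : Λ → G) (ψ : Hilb G) (c : Bond → G) :
    (shiftObs Λ t : Hilb G →L[ℂ] Hilb G) ψ c = ψ (patch Λ 1 t⁻¹ * c) := by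
  change embed Λ _ ψ c = _
  have h1 : ∀ x : Λ → G, res Λ c = t * x ↔ t⁻¹ * res Λ c = x := fun x =>
    eq_comm.trans (eq_inv_mul_iff_mul_eq.symm.trans eq_comm)
  rw [embed_apply]
  simp only [Matrix.of_apply, h1, ite_mul, one_mul, zero_mul, Finset.sum_ite_eq, Finset.mem_univ,
    if_true]
  refine congrArg (fun d => (ψ d : ℂ)) (funext fun e => ?_)
  by_cases h : e ∈ Λ <;> simp [patch, h, res]

theorem star_diagonalObs (Λ : Finset Bond) (d : (Λ → G) → ℂ) :
    star (diagonalObs Λ d) = diagonalObs Λ (star d) := by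
  rw [diagonalObs, star_obs, Matrix.star_eq_conjTranspose, Matrix.diagonal_conjTranspose]
  rfl

theorem star_shiftObs (Λ : Finset Bond) (t : Λ → G) :
    star (shiftObs Λ t) = shiftObs Λ t⁻¹ := by
  rw [shiftObs, star_obs, shiftObs]
  congr 1
  ext a b
  have h1 : b = t * a ↔ a = t⁻¹ * b := eq_comm.trans eq_inv_mul_iff_mul_eq.symm
  simp [Matrix.star_apply, h1, apply_ite]

theorem shiftObs_mul (Λ : Finset Bond) (s t : Λ → G) :
    shiftObs Λ s * shiftObs Λ t = shiftObs Λ (s * t) := by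
  refine quasiLocal_ext fun ψ c => ?_
  change (shiftObs Λ s : Hilb G →L[ℂ] Hilb G) ((shiftObs Λ t : Hilb G →L[ℂ] Hilb G) ψ) c = _
  simp only [shiftObs_apply]
  refine congrArg (fun d => (ψ d : ℂ)) (funext fun e => ?_)
  by_cases h : e ∈ Λ
  · simp [patch, h, mul_comm, mul_assoc]
  · simp [patch, h]

theorem shiftObs_one (Λ : Finset Bond) : shiftObs Λ (1 : Λ → G) = 1 := by
  refine quasiLocal_ext fun ψ c => ?_
  rw [shiftObs_apply]
  have : patch Λ 1 (1 : Λ → G)⁻¹ * c = c := by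
    funext e
    by_cases h : e ∈ Λ <;> simp [patch, h]
  rw [this]
  rfl

theorem diagonalObs_mul (Λ : Finset Bond) (d d' : (Λ → G) → ℂ) :
    diagonalObs Λ d * diagonalObs Λ d' = diagonalObs Λ (d * d') := by
  refine quasiLocal_ext fun ψ c => ?_
  change (diagonalObs Λ d : Hilb G →L[ℂ] Hilb G)
    ((diagonalObs Λ d' : Hilb G →L[ℂ] Hilb G) ψ) c = _
  simp only [diagonalObs_apply, Pi.mul_apply, mul_assoc]

theorem diagonalObs_one (Λ : Finset Bond) : diagonalObs Λ (1 : (Λ → G) → ℂ) = 1 := by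
  refine quasiLocal_ext fun ψ c => ?_
  rw [diagonalObs_apply, Pi.one_apply, one_mul]
  rfl

theorem diagonalObs_commute (Λ Λ' : Finset Bond) (d : (Λ → G) → ℂ) (d' : (Λ' → G) → ℂ) :
    Commute (diagonalObs Λ d) (diagonalObs Λ' d') := by
  refine quasiLocal_ext fun ψ c => ?_
  change (diagonalObs Λ d : Hilb G →L[ℂ] Hilb G)
    ((diagonalObs Λ' d' : Hilb G →L[ℂ] Hilb G) ψ) c =
    (diagonalObs Λ' d' : Hilb G →L[ℂ] Hilb G) ((diagonalObs Λ d : Hilb G →L[ℂ] Hilb G) ψ) c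
  simp only [diagonalObs_apply]
  ring

theorem shiftObs_commute (Λ Λ' : Finset Bond) (t : Λ → G) (t' : Λ' → G) :
    Commute (shiftObs Λ t) (shiftObs Λ' t') := by
  refine quasiLocal_ext fun ψ c => ?_
  change (shiftObs Λ t : Hilb G →L[ℂ] Hilb G)
    ((shiftObs Λ' t' : Hilb G →L[ℂ] Hilb G) ψ) c =
    (shiftObs Λ' t' : Hilb G →L[ℂ] Hilb G) ((shiftObs Λ t : Hilb G →L[ℂ] Hilb G) ψ) c
  simp only [shiftObs_apply, mul_left_comm]

/-- An operator that is diagonal in the configuration basis and does not depend on the bonds of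
`Λ` commutes with the observables of `Λ`. -/
theorem commute_of_diagonal {x y : quasiLocal G} {u : (Bond → G) → ℂ} {Λ : Finset Bond}
    (hx : ∀ (ψ : Hilb G) c, (x : Hilb G →L[ℂ] Hilb G) ψ c = u c * ψ c)
    (hu : ∀ c z, u (patch Λ c z) = u c) (hy : (y : Hilb G →L[ℂ] Hilb G) ∈ localAlg G Λ) :
    Commute y x := by
  obtain ⟨M, hM⟩ := hy
  have hM : (y : Hilb G →L[ℂ] Hilb G) = embed Λ M := hM.symm
  refine quasiLocal_ext fun ψ c => ?_
  change (y : Hilb G →L[ℂ] Hilb G) ((x : Hilb G →L[ℂ] Hilb G) ψ) c =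
    (x : Hilb G →L[ℂ] Hilb G) ((y : Hilb G →L[ℂ] Hilb G) ψ) c
  simp only [hM, embed_apply, hx, hu, Finset.mul_sum]
  exact Finset.sum_congr rfl fun z _ => mul_left_comm _ _ _

/-- An operator that shifts configurations away from the bonds of `Λ` commutes with the
observables of `Λ`. -/
theorem commute_of_shift {x y : quasiLocal G} {t : Bond → G} {Λ : Finset Bond}
    (hx : ∀ (ψ : Hilb G) c, (x : Hilb G →L[ℂ] Hilb G) ψ c = ψ (t * c))
    (ht : ∀ e ∈ Λ, t e = 1) (hy : (y : Hilb G →L[ℂ] Hilb G) ∈ localAlg G Λ) :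
    Commute y x := by
  obtain ⟨M, hM⟩ := hy
  have hM : (y : Hilb G →L[ℂ] Hilb G) = embed Λ M := hM.symm
  refine quasiLocal_ext fun ψ c => ?_
  change (y : Hilb G →L[ℂ] Hilb G) ((x : Hilb G →L[ℂ] Hilb G) ψ) c =
    (x : Hilb G →L[ℂ] Hilb G) ((y : Hilb G →L[ℂ] Hilb G) ψ) c
  have h1 : res Λ (t * c) = res Λ c := by
    funext e
    simp [res, ht e e.2]
  have h2 : ∀ z, t * patch Λ c z = patch Λ (t * c) z := by
    intro z
    funext e
    by_cases h : e ∈ Λ <;> simp [patch, h, ht]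
  simp only [hM, embed_apply, hx, h1, h2]

/-! ### Characters -/

theorem conj_char (χ : Chars G) (g : G) : (starRingEnd ℂ) (χ g : ℂ) = (χ g⁻¹ : ℂ) := by
  have h1 : (χ g : ℂ) ^ Fintype.card G = 1 := by
    rw [← Units.val_pow_eq_pow_val, ← map_pow, pow_card_eq_one, map_one, Units.val_one]
  rw [map_inv, Units.val_inv_eq_inv_val,
    Complex.inv_eq_conj (Complex.norm_eq_one_of_pow_eq_one h1 Fintype.card_ne_zero)]

theorem card_ne_zero' : (Fintype.card G : ℂ) ≠ 0 := Nat.cast_ne_zero.2 Fintype.card_ne_zero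

theorem sum_char (χ : Chars G) [Decidable (χ = 1)] :
    ∑ g, (χ g : ℂ) = if χ = 1 then (Fintype.card G : ℂ) else 0 := by
  split_ifs with h
  · simp [h]
  · obtain ⟨k, hk⟩ := DFunLike.ne_iff.1 h
    have h1 : (χ k : ℂ) * ∑ g, (χ g : ℂ) = ∑ g, (χ g : ℂ) := by
      rw [Finset.mul_sum]
      refine Fintype.sum_equiv (Equiv.mulLeft k) _ _ fun g => ?_
      simp
    have h2 : ((χ k : ℂ) - 1) * ∑ g, (χ g : ℂ) = 0 := by rw [sub_mul, h1, one_mul, sub_self]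
    refine (mul_eq_zero.1 h2).resolve_left (sub_ne_zero.2 fun h3 => hk ?_)
    exact Units.ext h3

theorem sum_chars (g : G) :
    ∑ χ : Chars G, (χ g : ℂ) = if g = 1 then (Fintype.card G : ℂ) else 0 := by
  split_ifs with h
  · have h1 := CommGroup.card_monoidHom_of_hasEnoughRootsOfUnity G ℂ
    rw [Nat.card_eq_fintype_card, Nat.card_eq_fintype_card] at h1
    simp [h, h1]
  · obtain ⟨ξ, hξ⟩ := CommGroup.exists_apply_ne_one_of_hasEnoughRootsOfUnity G ℂ h
    have h1 : (ξ g : ℂ) * ∑ χ : Chars G, (χ g : ℂ) = ∑ χ : Chars G, (χ g : ℂ) := by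
      rw [Finset.mul_sum]
      refine Fintype.sum_equiv (Equiv.mulLeft ξ) _ _ fun χ => ?_
      simp
    have h2 : ((ξ g : ℂ) - 1) * ∑ χ : Chars G, (χ g : ℂ) = 0 := by
      rw [sub_mul, h1, one_mul, sub_self]
    exact (mul_eq_zero.1 h2).resolve_left (sub_ne_zero.2 fun h3 => hξ (Units.ext h3))

/-! ### Boxes -/

theorem mem_square (L : ℕ) (v : Vertex) :
    v ∈ square L ↔ (-(L : ℤ) ≤ v.1 ∧ v.1 ≤ L) ∧ -(L : ℤ) ≤ v.2 ∧ v.2 ≤ L := by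
  rw [square, Finset.mem_product, Finset.mem_Icc, Finset.mem_Icc]

theorem mem_box (L : ℕ) (e : Bond) : e ∈ box L ↔ e.source ∈ square L ∧ e.target ∈ square L := by
  simp [box, Bond.source]

theorem square_mono : Monotone square := by
  intro L M h v hv
  rw [mem_square] at hv ⊢
  omega

theorem box_mono : Monotone box := by
  intro L M h e he
  rw [mem_box] at he ⊢
  exact ⟨square_mono h he.1, square_mono h he.2⟩

theorem exists_subset_box (Λ : Finset Bond) : ∃ L, Λ ⊆ box L := by
  induction Λ using Finset.induction_on with
  | empty => exact ⟨0, Finset.empty_subset _⟩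
  | insert e Λ he ih =>
    obtain ⟨L, hL⟩ := ih
    refine ⟨max L (e.1.1.natAbs + e.1.2.natAbs + 1), Finset.insert_subset ?_ ?_⟩
    · rw [mem_box, mem_square, mem_square]
      obtain ⟨⟨x, y⟩, b⟩ := e
      have h1 := neg_abs_le x
      have h2 := le_abs_self x
      have h3 := neg_abs_le y
      have h4 := le_abs_self y
      cases b <;> simp [Bond.source, Bond.target] <;> omega
    · exact hL.trans (box_mono (le_max_left _ _))

theorem verts_mono : Monotone verts := by
  intro L M h v hv
  rw [mem_verts_iff] at hv ⊢
  exact hv.trans (box_mono h)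

theorem faces_mono : Monotone faces := by
  intro L M h f hf
  rw [mem_faces_iff] at hf ⊢
  exact hf.trans (box_mono h)

theorem exists_mem_verts (v : Vertex) : ∃ L, v ∈ verts L := by
  obtain ⟨L, hL⟩ := exists_subset_box (starAt v)
  exact ⟨L, (mem_verts_iff L v).2 hL⟩

theorem exists_mem_faces (f : Face) : ∃ L, f ∈ faces L := by
  obtain ⟨L, hL⟩ := exists_subset_box (plaquette f)
  exact ⟨L, (mem_faces_iff L f).2 hL⟩

/-! ### The electric charges -/

theorem gauge_one (v : Vertex) : gauge v (1 : G) = 1 := by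
  funext e
  simp [gauge]

theorem gauge_mul (v : Vertex) (g h : G) : gauge v (g * h) = gauge v g * gauge v h := by
  funext e
  simp only [gauge, Pi.mul_apply]
  split_ifs
  · rw [mul_inv_cancel, mul_inv_cancel, mul_inv_cancel, one_mul]
  · simp
  · simp [mul_comm]
  · simp

theorem gauge_inv (v : Vertex) (g : G) : gauge v g⁻¹ = (gauge v g)⁻¹ := by
  rw [eq_inv_iff_mul_eq_one, ← gauge_mul, inv_mul_cancel, gauge_one]

theorem starOp_eq (v : Vertex) (g : G) :
    starOp v g = shiftObs (starAt v) (res (starAt v) (gauge v g)) := rfl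

theorem starOp_mul (v : Vertex) (g h : G) : starOp v g * starOp v h = starOp v (g * h) := by
  rw [starOp_eq, starOp_eq, shiftObs_mul, starOp_eq, gauge_mul]
  rfl

theorem starOp_one (v : Vertex) : starOp v (1 : G) = 1 := by
  rw [starOp_eq, gauge_one]
  exact shiftObs_one _

theorem star_starOp (v : Vertex) (g : G) : star (starOp v g) = starOp v g⁻¹ := by
  rw [starOp_eq, star_shiftObs, starOp_eq, gauge_inv]
  rfl

theorem star_electric (v : Vertex) (χ : Chars G) : star (electric v χ) = electric v χ := by
  rw [electric, star_smul, star_sum, Complex.star_def, map_inv₀, Complex.conj_natCast]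
  congr 1
  refine Fintype.sum_equiv (Equiv.inv G) _ _ fun g => ?_
  rw [star_smul, star_starOp, Equiv.inv_apply, Complex.star_def, conj_char, conj_char]

theorem starOp_mul_electric (v : Vertex) (g : G) (χ : Chars G) :
    starOp v g * electric v χ = (χ g : ℂ) • electric v χ := by
  rw [electric, mul_smul_comm, smul_comm (χ g : ℂ)]
  congr 1
  rw [Finset.mul_sum, Finset.smul_sum]
  refine Fintype.sum_equiv (Equiv.mulLeft g) _ _ fun h => ?_
  rw [mul_smul_comm, starOp_mul, Equiv.coe_mulLeft, smul_smul, conj_char, conj_char,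
    ← Units.val_mul, ← map_mul, mul_inv, mul_inv_cancel_left]

theorem electric_mul [DecidableEq (Chars G)] (v : Vertex) (χ ξ : Chars G) :
    electric v χ * electric v ξ = if χ = ξ then electric v ξ else 0 := by
  have h1 : ∑ g, (starRingEnd ℂ) (χ g : ℂ) * (ξ g : ℂ) =
      if χ = ξ then (Fintype.card G : ℂ) else 0 := by
    have := sum_char (χ⁻¹ * ξ)
    have e : χ⁻¹ * ξ = 1 ↔ χ = ξ := @inv_mul_eq_one (Chars G) _ χ ξ
    simp only [e] at this
    rw [← this]
    refine Finset.sum_congr rfl fun g _ => ?_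
    rw [conj_char, ← Units.val_mul, map_inv]
    rfl
  conv_lhs => rw [electric]
  rw [smul_mul_assoc, Finset.sum_mul]
  simp only [smul_mul_assoc, starOp_mul_electric, smul_smul]
  rw [← Finset.sum_smul, h1, smul_smul]
  split_ifs
  · rw [inv_mul_cancel₀ card_ne_zero', one_smul]
  · rw [mul_zero, zero_smul]

theorem sum_char_smul_electric (v : Vertex) (g : G) :
    ∑ χ : Chars G, (χ g : ℂ) • electric v χ = starOp v g := by
  simp only [electric, Finset.smul_sum, smul_smul, mul_left_comm _ (Fintype.card G : ℂ)⁻¹]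
  rw [Finset.sum_comm]
  have h1 : ∀ h : G, ∑ χ : Chars G, (Fintype.card G : ℂ)⁻¹ * ((χ g : ℂ) *
      (starRingEnd ℂ) (χ h : ℂ)) = if g = h then 1 else 0 := by
    intro h
    have := sum_chars (g * h⁻¹)
    simp only [mul_inv_eq_one] at this
    simp only [conj_char, ← Units.val_mul, ← map_mul]
    rw [← Finset.mul_sum, this, mul_ite, mul_zero, inv_mul_cancel₀ card_ne_zero']
  simp only [← Finset.sum_smul, h1]
  simp

variable (G) in
/-- The electric charges: the measurements `D_v^χ` at the vertices. -/
noncomputable def electricSystem : ChargeSystem (quasiLocal G) (Chars G) where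
  proj := electric
  star_proj := star_electric
  proj_mul_self v χ := by
    classical rw [electric_mul, if_pos rfl]
  proj_mul_of_ne v χ ξ h := by
    classical rw [electric_mul, if_neg h]
  sum_proj v := by
    rw [← starOp_one v, ← sum_char_smul_electric]
    simp
  commute := electric_commute
  region := verts
  region_mono := verts_mono
  exists_mem_region := exists_mem_verts

theorem electricTotal_eq (L : ℕ) (χ : Chars G) :
    electricTotal L χ = (electricSystem G).total L χ := by
  rw [electricTotal, ChargeSystem.total, ChargeSystem.calculus_apply, Finset.sum_filter]
  refine Finset.sum_congr rfl fun κ _ => ?_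
  rw [ite_smul, one_smul, zero_smul]
  by_cases h : ∏ v, κ v = χ
  · rw [if_pos h]
    exact (if_pos h).symm
  · rw [if_neg h]
    exact (if_neg h).symm

/-! ### The magnetic charges -/

theorem faceOp_eq (f : Face) (h : G) :
    faceOp f h = diagonalObs (plaquette f) fun a => if monodromy f a = h then 1 else 0 := rfl

variable (G) in
/-- The magnetic charges: the measurements `D_f^c` at the faces. -/
noncomputable def magneticSystem : ChargeSystem (quasiLocal G) G where
  proj := magnetic
  star_proj f c := by
    rw [magnetic, faceOp_eq, star_diagonalObs]
    congr 1
    funext a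
    change star (if monodromy f a = c then (1 : ℂ) else 0) = _
    split_ifs <;> simp
  proj_mul_self f c := by
    rw [magnetic, faceOp_eq, diagonalObs_mul]
    congr 1
    funext a
    simp
  proj_mul_of_ne f c d h := by
    rw [magnetic, magnetic, faceOp_eq, faceOp_eq, diagonalObs_mul]
    refine quasiLocal_ext fun ψ x => ?_
    rw [diagonalObs_apply, Pi.mul_apply]
    change _ = (0 : ℂ)
    by_cases h1 : monodromy f (res (plaquette f) x) = c
    · have h3 : ¬ monodromy f (res (plaquette f) x) = d := fun h2 => h (h1.symm.trans h2)
      rw [if_neg h3]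
      simp
    · simp [h1]
  sum_proj f := by
    refine quasiLocal_ext fun ψ x => ?_
    refine (map_sum (coeff ψ x) _ _).trans ?_
    change ∑ c : G, (faceOp f c : Hilb G →L[ℂ] Hilb G) ψ x = ψ x
    simp [faceOp_apply]
  commute := faceOp_commute
  region := faces
  region_mono := faces_mono
  exists_mem_region := exists_mem_faces

theorem magneticTotal_eq (L : ℕ) (c : G) :
    magneticTotal L c = (magneticSystem G).total L c := by
  rw [magneticTotal, ChargeSystem.total, ChargeSystem.calculus_apply, Finset.sum_filter]
  refine Finset.sum_congr rfl fun κ _ => ?_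
  rw [ite_smul, one_smul, zero_smul]
  by_cases h : ∏ f, κ f = c
  · rw [if_pos h]
    exact (if_pos h).symm
  · rw [if_neg h]
    exact (if_neg h).symm

/-! ### Total charges are measured on the boundary -/

theorem eventually_endpoints_mem_verts (Λ : Finset Bond) :
    ∀ᶠ L in atTop, ∀ e ∈ Λ, e.source ∈ verts L ∧ e.target ∈ verts L := by
  rw [Filter.eventually_all_finset]
  intro e _
  obtain ⟨L, hL⟩ := exists_mem_verts e.source
  obtain ⟨M, hM⟩ := exists_mem_verts e.target
  filter_upwards [eventually_ge_atTop L, eventually_ge_atTop M] with N h1 h2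
  exact ⟨verts_mono h1 hL, verts_mono h2 hM⟩

/-- The gauge transformations at the two endpoints of a bond cancel on the bond. -/
theorem gauge_prod_eq_one {s : Finset Vertex} {e : Bond} (h1 : e.source ∈ s) (h2 : e.target ∈ s)
    (g : G) : (∏ v ∈ s, gauge v g) e = 1 := by
  rw [Finset.prod_apply]
  simp only [gauge]
  rw [Finset.prod_mul_distrib, Finset.prod_ite_eq, Finset.prod_ite_eq, if_pos h1, if_pos h2,
    mul_inv_cancel]

/-- Evaluation of characters at `g`, as a complex character of the group of characters. -/
noncomputable def evalChar (g : G) : Chars G →* ℂ := (Units.coeHom ℂ).comp (MonoidHom.eval g)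

/-- The product over the vertices of the box of the gauge transformations by `g` depends on the
total charge only. -/
theorem calculus_evalChar_apply (L : ℕ) (g : G) (ψ : Hilb G) (c : Bond → G) :
    (((electricSystem G).calculus L fun κ => evalChar g (∏ v, κ v) : quasiLocal G) :
      Hilb G →L[ℂ] Hilb G) ψ c = ψ ((∏ v ∈ verts L, gauge v g)⁻¹ * c) := by
  refine ChargeSystem.calculus_prod_induction (S := electricSystem G) (evalChar g)
    (motive := fun s x => ∀ c, (x : Hilb G →L[ℂ] Hilb G) ψ c =
      ψ ((∏ v ∈ s, gauge v g)⁻¹ * c)) ?_ ?_ c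
  · intro c
    rw [Finset.prod_empty, inv_one, one_mul]
    rfl
  · intro v s x hv ih c
    have h1 : ∑ χ, evalChar g χ • (electricSystem G).proj v χ = starOp v g :=
      sum_char_smul_electric v g
    rw [h1, Finset.prod_insert hv]
    change (starOp v g : Hilb G →L[ℂ] Hilb G) ((x : Hilb G →L[ℂ] Hilb G) ψ) c = _
    rw [starOp_apply, ih, mul_inv, mul_assoc, mul_left_comm]

/-- Fourier inversion for the total electric charge of the box. -/
theorem electric_total_eq_sum (L : ℕ) (χ : Chars G) :
    (electricSystem G).total L χ = (Fintype.card G : ℂ)⁻¹ • ∑ g : G, (χ g⁻¹ : ℂ) •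
      (electricSystem G).calculus L fun κ => evalChar g (∏ v, κ v) := by
  classical
  simp only [← map_smul, ← map_sum, ChargeSystem.total]
  congr 1
  funext κ
  simp only [Pi.smul_apply, Finset.sum_apply, smul_eq_mul]
  have h1 := sum_char (χ⁻¹ * ∏ v, κ v)
  have e : χ⁻¹ * ∏ v, κ v = 1 ↔ ∏ v, κ v = χ :=
    (@inv_mul_eq_one (Chars G) _ χ _).trans eq_comm
  simp only [e] at h1
  have h2 : ∑ g : G, (χ g⁻¹ : ℂ) * evalChar g (∏ v, κ v) =
      ∑ g : G, ((χ⁻¹ * ∏ v, κ v : Chars G) g : ℂ) := by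
    refine Finset.sum_congr rfl fun g _ => ?_
    rw [map_inv]
    rfl
  rw [h2, h1]
  split_ifs
  · rw [inv_mul_cancel₀ card_ne_zero']
  · rw [mul_zero]

/-- If the box contains both endpoints of each bond of `Λ`, the product of the gauge
transformations by `g` in the box acts away from `Λ`. -/
theorem electric_total_commute {x : quasiLocal G} (hx : x ∈ localObs G) (χ : Chars G) :
    ∀ᶠ L in atTop, Commute x ((electricSystem G).total L χ) := by
  obtain ⟨Λ, hΛ⟩ := hx
  filter_upwards [eventually_endpoints_mem_verts Λ] with L hL
  rw [electric_total_eq_sum]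
  refine Commute.smul_right (Commute.sum_right _ _ _ fun g _ => Commute.smul_right ?_ _) _
  refine commute_of_shift (calculus_evalChar_apply L g) (fun e he => ?_) hΛ
  rw [Pi.inv_apply, gauge_prod_eq_one (hL e he).1 (hL e he).2, inv_one]

/-- The clockwise monodromy around `f` of a configuration on all bonds. -/
def loop (f : Face) : (Bond → G) →* G where
  toFun c := monodromy f (res (plaquette f) c)
  map_one' := by simp [monodromy, res]
  map_mul' c d := by simp [monodromy, res, mul_zpow, Finset.prod_mul_distrib]

theorem loop_apply (f : Face) (c : Bond → G) : loop f c =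
    c (f, true) * c ((f.1, f.2 + 1), false) * (c (f, false))⁻¹ * (c ((f.1 + 1, f.2), true))⁻¹ := by
  change ∏ e : plaquette f, c e ^ orient f e = _
  rw [Finset.prod_coe_sort (plaquette f) fun e => c e ^ orient f e]
  obtain ⟨x, y⟩ := f
  simp [plaquette, orient]
  ac_rfl

theorem faceOp_apply' (f : Face) (h : G) (ψ : Hilb G) (c : Bond → G) :
    (faceOp f h : Hilb G →L[ℂ] Hilb G) ψ c = if loop f c = h then ψ c else 0 :=
  faceOp_apply f h ψ c

theorem magnetic_total_apply (L : ℕ) (d : G) (ψ : Hilb G) (c : Bond → G) :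
    ((magneticSystem G).total L d : Hilb G →L[ℂ] Hilb G) ψ c =
      (if ∏ f ∈ faces L, loop f c = d then 1 else 0) * ψ c := by
  classical
  refine (ChargeSystem.apply_total (S := magneticSystem G) (coeff ψ c) (fun f => loop f c)
    (fun f h x => ?_) d).trans ?_
  · by_cases hh : loop f c = h
    · rw [if_pos hh]
      exact (faceOp_apply' f h _ c).trans (if_pos hh)
    · rw [if_neg hh]
      exact (faceOp_apply' f h _ c).trans (if_neg hh)
  · by_cases hd : ∏ f ∈ faces L, loop f c = d
    · rw [if_pos hd]
      exact congrArg (fun z => z * ψ c) (if_pos hd)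
    · rw [if_neg hd]
      exact congrArg (fun z => z * ψ c) (if_neg hd)

/-- A homomorphism that is trivial on the configurations supported at one bond of `Λ` does not
depend on the bonds of `Λ`. -/
theorem map_patch_eq (F : (Bond → G) →* G) {Λ : Finset Bond}
    (hF : ∀ e ∈ Λ, ∀ g, F (Pi.mulSingle e g) = 1) (c : Bond → G) (z : Λ → G) :
    F (patch Λ c z) = F c := by
  have h1 : patch Λ c z = (∏ e ∈ Λ, Pi.mulSingle e (patch Λ c z e * (c e)⁻¹)) * c := by
    funext e
    rw [Pi.mul_apply, Finset.prod_apply]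
    simp only [Pi.mulSingle_apply]
    rw [Finset.prod_ite_eq]
    split_ifs with h
    · rw [inv_mul_cancel_right]
    · simp [patch, h]
  rw [h1, map_mul, map_prod, Finset.prod_eq_one fun e he => hF e he _, one_mul]

/-- The faces below and above a bond to the right are traversed along it in opposite directions. -/
theorem loop_mulSingle_right (f p : Face) (h : G) :
    loop f (Pi.mulSingle ((p, false) : Bond) h) =
      (Pi.mulSingle (p.1, p.2 - 1) h * Pi.mulSingle p h⁻¹ : Face → G) f := by
  have e1 : ((f.1, f.2 + 1) : Face) = p ↔ f = (p.1, p.2 - 1) := by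
    constructor
    · rintro rfl; simp
    · rintro rfl; simp
  rw [loop_apply]
  simp only [Pi.mulSingle_apply, Pi.mul_apply, Prod.mk.injEq, and_true, Bool.true_eq_false,
    and_false, if_false, inv_one, mul_one, one_mul, e1]
  split_ifs <;> simp

/-- The faces to the left and to the right of an upward bond are traversed along it in opposite
directions. -/
theorem loop_mulSingle_up (f p : Face) (h : G) :
    loop f (Pi.mulSingle ((p, true) : Bond) h) =
      (Pi.mulSingle (p.1 - 1, p.2) h⁻¹ * Pi.mulSingle p h : Face → G) f := by
  have e1 : ((f.1 + 1, f.2) : Face) = p ↔ f = (p.1 - 1, p.2) := by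
    constructor
    · rintro rfl; simp
    · rintro rfl; simp
  rw [loop_apply]
  simp only [Pi.mulSingle_apply, Pi.mul_apply, Prod.mk.injEq, and_true, Bool.false_eq_true,
    and_false, if_false, inv_one, mul_one, e1]
  rw [mul_comm]
  split_ifs <;> simp

/-- If the box contains both faces at each bond of `Λ`, changing the configuration on `Λ` does not
change the product of the monodromies in the box. -/
theorem magnetic_total_commute {x : quasiLocal G} (hx : x ∈ localObs G) (d : G) :
    ∀ᶠ L in atTop, Commute x ((magneticSystem G).total L d) := by
  obtain ⟨Λ, hΛ⟩ := hx
  have hev : ∀ᶠ L in atTop, ∀ e ∈ Λ, (e.1 ∈ faces L ∧ (e.1.1, e.1.2 - 1) ∈ faces L) ∧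
      (e.1.1 - 1, e.1.2) ∈ faces L := by
    rw [Filter.eventually_all_finset]
    intro e _
    exact ((magneticSystem G).eventually_mem_region e.1).and
      ((magneticSystem G).eventually_mem_region (e.1.1, e.1.2 - 1)) |>.and
      ((magneticSystem G).eventually_mem_region (e.1.1 - 1, e.1.2))
  filter_upwards [hev] with L hL
  refine commute_of_diagonal (magnetic_total_apply L d) (fun c z => ?_) hΛ
  have hF : ∀ e ∈ Λ, ∀ g : G, (∏ f ∈ faces L, loop f) (Pi.mulSingle e g) = 1 := by
    intro e he g
    obtain ⟨⟨h1, h2⟩, h3⟩ := hL e he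
    obtain ⟨p, b⟩ := e
    rw [MonoidHom.finsetProd_apply]
    cases b
    · simp only [loop_mulSingle_right, Pi.mul_apply]
      rw [Finset.prod_mul_distrib]
      simp only [Pi.mulSingle_apply]
      rw [Finset.prod_ite_eq', Finset.prod_ite_eq', if_pos h1, if_pos h2, mul_inv_cancel]
    · simp only [loop_mulSingle_up, Pi.mul_apply]
      rw [Finset.prod_mul_distrib]
      simp only [Pi.mulSingle_apply]
      rw [Finset.prod_ite_eq', Finset.prod_ite_eq', if_pos h1, if_pos h3, inv_mul_cancel]
  have h4 := map_patch_eq _ hF c z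
  rw [MonoidHom.finsetProd_apply, MonoidHom.finsetProd_apply] at h4
  rw [h4]

/-! ### Gauge invariance of the magnetic charges -/

theorem gauge_apply (v : Vertex) (g : G) (e : Bond) :
    gauge v g e = (Pi.mulSingle v g : Vertex → G) e.source *
      ((Pi.mulSingle v g : Vertex → G) e.target)⁻¹ := by
  simp only [gauge, Pi.mulSingle_apply]
  split_ifs <;> simp

theorem loop_gauge (f v : ℤ × ℤ) (g : G) : loop f (gauge v g) = 1 := by
  rw [loop_apply]
  simp only [gauge_apply, Bond.source, Bond.target, if_true, Bool.false_eq_true, if_false]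
  apply Additive.ofMul.injective
  simp only [ofMul_mul, ofMul_inv, ofMul_one]
  abel

theorem starOp_commute_faceOp (v f : ℤ × ℤ) (g h : G) : Commute (starOp v g) (faceOp f h) := by
  refine quasiLocal_ext fun ψ c => ?_
  change (starOp v g : Hilb G →L[ℂ] Hilb G) ((faceOp f h : Hilb G →L[ℂ] Hilb G) ψ) c =
    (faceOp f h : Hilb G →L[ℂ] Hilb G) ((starOp v g : Hilb G →L[ℂ] Hilb G) ψ) c
  simp only [faceOp_apply', starOp_apply, map_mul, map_inv, loop_gauge, inv_one, one_mul]

theorem electric_commute_magnetic (v f : ℤ × ℤ) (χ : Chars G) (c : G) :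
    Commute (electric v χ) (magnetic f c) :=
  Commute.smul_left (Commute.sum_left _ _ _ fun g _ =>
    Commute.smul_left (starOp_commute_faceOp v f g c) _) _

/-! ### Moving charges across a bond -/

/-- The operator `|a⟩ ↦ χ(a_e) |a⟩`, which moves the electric charge `χ` along the bond `e`. -/
noncomputable def bondPhase (e : Bond) (χ : Chars G) : quasiLocal G :=
  diagonalObs {e} fun a => (χ (a ⟨e, Finset.mem_singleton_self e⟩) : ℂ)

theorem bondPhase_apply (e : Bond) (χ : Chars G) (ψ : Hilb G) (c : Bond → G) :
    (bondPhase e χ : Hilb G →L[ℂ] Hilb G) ψ c = (χ (c e) : ℂ) * ψ c :=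
  diagonalObs_apply _ _ ψ c

/-- The operator that multiplies the configuration at the bond `e` by `h`, which moves the magnetic
charge `h` across the bond `e`. -/
noncomputable def bondShift (e : Bond) (h : G) : quasiLocal G := shiftObs {e} fun _ => h

theorem bondShift_apply (e : Bond) (h : G) (ψ : Hilb G) (c : Bond → G) :
    (bondShift e h : Hilb G →L[ℂ] Hilb G) ψ c = ψ (Pi.mulSingle e h⁻¹ * c) := by
  rw [bondShift, shiftObs_apply]
  refine congrArg (fun d => (ψ d : ℂ)) ?_
  congr 1
  funext e'
  by_cases h1 : e' = e
  · subst h1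
    simp [patch]
  · simp [patch, h1]

theorem obs_mem_localObs (Λ : Finset Bond) (M : Matrix (Λ → G) (Λ → G) ℂ) :
    obs Λ M ∈ localObs G := ⟨Λ, M, rfl⟩

theorem bondPhase_mul_starOp (e : Bond) (χ : Chars G) (v : Vertex) (g : G) :
    bondPhase e χ * starOp v g = (χ (gauge v g e) : ℂ) • (starOp v g * bondPhase e χ) := by
  refine quasiLocal_ext fun ψ c => ?_
  change (bondPhase e χ : Hilb G →L[ℂ] Hilb G) ((starOp v g : Hilb G →L[ℂ] Hilb G) ψ) c =
    (χ (gauge v g e) : ℂ) * (starOp v g : Hilb G →L[ℂ] Hilb G)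
      ((bondPhase e χ : Hilb G →L[ℂ] Hilb G) ψ) c
  rw [starOp_apply, bondPhase_apply, bondPhase_apply, starOp_apply, ← mul_assoc, ← Units.val_mul,
    ← map_mul]
  simp

theorem moves_bondPhase (e : Bond) (χ : Chars G) :
    ChargeSystem.Moves (electricSystem G) (magneticSystem G) (bondPhase e χ)
      (Pi.mulSingle e.source χ⁻¹ * Pi.mulSingle e.target χ) where
  star_mul_self := by
    rw [bondPhase, star_diagonalObs, diagonalObs_mul, ← diagonalObs_one {e}]
    congr 1
    funext a
    change (starRingEnd ℂ) (χ _ : ℂ) * (χ _ : ℂ) = 1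
    rw [conj_char, ← Units.val_mul, ← map_mul]
    simp
  mul_star_self := by
    rw [bondPhase, star_diagonalObs, diagonalObs_mul, ← diagonalObs_one {e}]
    congr 1
    funext a
    change (χ _ : ℂ) * (starRingEnd ℂ) (χ _ : ℂ) = 1
    rw [conj_char, ← Units.val_mul, ← map_mul]
    simp
  mul_proj v ξ := by
    change bondPhase e χ * electric v ξ = electric v _ * bondPhase e χ
    rw [electric, electric, mul_smul_comm, smul_mul_assoc, Finset.mul_sum, Finset.sum_mul]
    congr 1
    refine Finset.sum_congr rfl fun g _ => ?_
    rw [mul_smul_comm, bondPhase_mul_starOp, smul_smul, smul_mul_assoc]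
    congr 1
    rw [conj_char, conj_char, ← Units.val_mul]
    congr 1
    rw [gauge_apply]
    simp only [Pi.mul_apply, Pi.mulSingle_apply, eq_comm (a := v), MonoidHom.mul_apply]
    split_ifs <;> simp
  commute f c := diagonalObs_commute _ _ _ _

theorem bondShift_mul_faceOp (e : Bond) (h : G) (f : Face) (c : G) :
    bondShift e h * faceOp f c = faceOp f (c * loop f (Pi.mulSingle e h)) * bondShift e h := by
  refine quasiLocal_ext fun ψ x => ?_
  change (bondShift e h : Hilb G →L[ℂ] Hilb G) ((faceOp f c : Hilb G →L[ℂ] Hilb G) ψ) x =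
    (faceOp f (c * loop f (Pi.mulSingle e h)) : Hilb G →L[ℂ] Hilb G)
      ((bondShift e h : Hilb G →L[ℂ] Hilb G) ψ) x
  rw [bondShift_apply, faceOp_apply', faceOp_apply', bondShift_apply, map_mul, Pi.mulSingle_inv,
    map_inv]
  have e1 : (loop f (Pi.mulSingle e h))⁻¹ * loop f x = c ↔
      loop f x = c * loop f (Pi.mulSingle e h) := by
    rw [inv_mul_eq_iff_eq_mul, mul_comm c]
  simp only [e1]

theorem moves_bondShift (e : Bond) (h : G) {s : Face → G}
    (hs : ∀ f, loop f (Pi.mulSingle e h) = s f) :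
    ChargeSystem.Moves (magneticSystem G) (electricSystem G) (bondShift e h) s where
  star_mul_self := by
    rw [bondShift, star_shiftObs, shiftObs_mul, inv_mul_cancel, shiftObs_one]
  mul_star_self := by
    rw [bondShift, star_shiftObs, shiftObs_mul, mul_inv_cancel, shiftObs_one]
  mul_proj f c := by
    rw [← hs]
    exact bondShift_mul_faceOp e h f c
  commute v χ := Commute.smul_right (Commute.sum_right _ _ _ fun _ _ =>
    Commute.smul_right (shiftObs_commute _ _ _ _) _) _

/-! ### Local observables -/

theorem mul_mem_localObs {x y : quasiLocal G} (hx : x ∈ localObs G) (hy : y ∈ localObs G) :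
    x * y ∈ localObs G := by
  obtain ⟨Λ, hΛ⟩ := hx
  obtain ⟨Λ', hΛ'⟩ := hy
  exact ⟨Λ ∪ Λ', mul_mem (localAlg_mono Finset.subset_union_left hΛ)
    (localAlg_mono Finset.subset_union_right hΛ')⟩

theorem star_mem_localObs {x : quasiLocal G} (hx : x ∈ localObs G) : star x ∈ localObs G := by
  obtain ⟨Λ, hΛ⟩ := hx
  exact ⟨Λ, star_mem hΛ⟩

theorem one_mem_localObs : (1 : quasiLocal G) ∈ localObs G := ⟨∅, one_mem _⟩

theorem electric_mem_localObs (v : Vertex) (χ : Chars G) : electric v χ ∈ localObs G := by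
  refine ⟨starAt v, ?_⟩
  have h : ∀ g : G, ((starOp v g : quasiLocal G) : Hilb G →L[ℂ] Hilb G) ∈
      localAlg G (starAt v) := fun g => ⟨_, rfl⟩
  rw [electric]
  push_cast
  exact SMulMemClass.smul_mem _ (sum_mem fun g _ => SMulMemClass.smul_mem _ (h g))

theorem magnetic_mem_localObs (f : Face) (c : G) : magnetic f c ∈ localObs G :=
  obs_mem_localObs _ _

theorem dense_localObs : Dense (localObs G) := by
  intro x
  rw [closure_subtype]
  have h1 : (x : Hilb G →L[ℂ] Hilb G) ∈
      closure ((⨆ Λ : Finset Bond, localAlg G Λ : StarSubalgebra ℂ (Hilb G →L[ℂ] Hilb G)) :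
        Set (Hilb G →L[ℂ] Hilb G)) := x.2
  rw [StarSubalgebra.coe_iSup_of_directed (directed_of_isDirected_le
    fun Λ Λ' h => localAlg_mono h)] at h1
  refine closure_mono ?_ h1
  intro y hy
  obtain ⟨Λ, hΛ⟩ := Set.mem_iUnion.1 hy
  obtain ⟨M, hM⟩ := hΛ
  exact ⟨obs Λ M, obs_mem_localObs Λ M, hM⟩

variable (G) in
/-- The electric and the magnetic charges of the quantum double model. -/
noncomputable def chargePair : ChargePair (quasiLocal G) (Chars G) G where
  fst := electricSystem G
  snd := magneticSystem G
  commute := electric_commute_magnetic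
  loc := localObs G
  dense_loc := dense_localObs
  commute_fst _ hx χ := electric_total_commute hx χ
  commute_snd _ hx c := magnetic_total_commute hx c

theorem chargePair_charge (L : ℕ) (χ : Chars G) (c : G) :
    (chargePair G).charge L χ c = charge L χ c := by
  rw [charge, electricTotal_eq, magneticTotal_eq]
  rfl

theorem electric_one (v : Vertex) : electric v (1 : Chars G) = starTerm G v := by
  simp [electric, starTerm]

theorem ham_eq (L : ℕ) :
    ham G L = (electricSystem G).energy L + (magneticSystem G).energy L := by
  simp only [ham, ← electric_one]
  rfl

theorem eventually_notMem_of_injective {Λ : Finset Bond} {e : ℕ → Bond}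
    (he : Function.Injective e) : ∀ᶠ k in atTop, e k ∉ Λ := by
  rw [← Nat.cofinite_eq_atTop]
  exact he.tendsto_cofinite.eventually (Λ.eventually_cofinite_notMem)

theorem mobile_chargePair : (chargePair G).Mobile := by
  intro χ
  refine ⟨fun k => bondPhase (((k : ℤ), 0), false) χ, fun k => moves_bondPhase _ χ, ?_⟩
  rintro x ⟨Λ, hΛ⟩
  filter_upwards [eventually_notMem_of_injective (Λ := Λ)
    (e := fun k : ℕ => (((k : ℤ), 0), false)) fun k l h => by simpa using h] with k hk
  refine (commute_of_diagonal (bondPhase_apply _ χ) (fun c z => ?_) hΛ).symm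
  rw [patch, dif_neg hk]

theorem mobile_swap_chargePair : (chargePair G).swap.Mobile := by
  intro h
  refine ⟨fun k => bondShift (((k + 1 : ℤ), 0), true) h, fun k => moves_bondShift _ h
    fun f => ?_, ?_⟩
  · rw [loop_mulSingle_up, add_sub_cancel_right]
  rintro x ⟨Λ, hΛ⟩
  filter_upwards [eventually_notMem_of_injective (Λ := Λ)
    (e := fun k : ℕ => (((k + 1 : ℤ), 0), true)) fun k l h => by simpa using h] with k hk
  refine (commute_of_shift (bondShift_apply _ h) (fun e he => ?_) hΛ).symm
  exact Pi.mulSingle_eq_of_ne (fun h' => hk (by rwa [← h'])) _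

/-! ### Ground states have at most one charge -/

/-- An equivalence relation on `ℤ × ℤ` that relates neighbours relates all sites. -/
theorem forall_of_neighbours {r : ℤ × ℤ → ℤ × ℤ → Prop} (hr : Equivalence r)
    (h1 : ∀ x y, r (x, y) (x + 1, y)) (h2 : ∀ x y, r (x, y) (x, y + 1)) (i j : ℤ × ℤ) :
    r i j := by
  have key : ∀ x y, r (0, 0) (x, y) := by
    intro x y
    have hx : r (0, 0) (x, 0) := by
      induction x using Int.induction_on with
      | zero => exact hr.refl _
      | succ n ih => exact hr.trans ih (h1 _ _)
      | pred n ih =>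
        have := h1 (-(n : ℤ) - 1) 0
        rw [sub_add_cancel] at this
        exact hr.trans ih (hr.symm this)
    induction y using Int.induction_on with
    | zero => exact hx
    | succ n ih => exact hr.trans ih (h2 _ _)
    | pred n ih =>
      have := h2 x (-(n : ℤ) - 1)
      rw [sub_add_cancel] at this
      exact hr.trans ih (hr.symm this)
  exact hr.trans (hr.symm (key i.1 i.2)) (key j.1 j.2)

section Transport

variable {A B : Type*} [Fintype A] [CommGroup A] [Fintype B] [CommGroup B]
  (S : ChargeSystem (quasiLocal G) A) (T : ChargeSystem (quasiLocal G) B)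

/-- The charge `a` of `S` can be moved from `i` to `j` by a local unitary that leaves the charges
of `T` unchanged. -/
def Transports (a : A) (i j : ℤ × ℤ) : Prop :=
  ∃ u ∈ localObs G, ChargeSystem.Moves S T u (Pi.mulSingle i a⁻¹ * Pi.mulSingle j a)

theorem equivalence_transports (a : A) : Equivalence (Transports S T a) where
  refl i := ⟨1, one_mem_localObs, by
    rw [← Pi.mulSingle_mul, inv_mul_cancel, Pi.mulSingle_one]
    exact ChargeSystem.Moves.one⟩
  symm := by
    rintro i j ⟨u, hu, hm⟩
    refine ⟨star u, star_mem_localObs hu, ?_⟩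
    have := hm.star
    rwa [mul_inv, ← Pi.mulSingle_inv, ← Pi.mulSingle_inv, inv_inv, mul_comm] at this
  trans := by
    rintro i j k ⟨u, hu, hm⟩ ⟨v, hv, hn⟩
    refine ⟨u * v, mul_mem_localObs hu hv, ?_⟩
    have := hm.mul hn
    simp only [Pi.mulSingle_inv, mul_assoc, mul_inv_cancel_left] at this ⊢
    exact this

variable {S T}

/-- In a ground state two charges of the same species have probability zero: for the operator `u q`
that merges them, `ω ((u q)* δ(u q)) = -n ω(q)` with `n > 0`. -/
theorem atMostOne_of_groundState (hcomm : ∀ i j a b, Commute (S.proj i a) (T.proj j b))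
    (hS : ∀ i a, S.proj i a ∈ localObs G) (hham : ∀ L, ham G L = S.energy L + T.energy L)
    (htr : ∀ a i j, Transports S T a i j) {ω : WeakDual ℂ (quasiLocal G)}
    (hω : ω ∈ groundStates G) : S.AtMostOne ω := by
  intro i j a b hij ha hb
  obtain ⟨u, hu, hm⟩ := htr a i j
  obtain ⟨n, hn, hen⟩ := hm.exists_energy_commutator hij ha hb
  set q := S.proj i a * S.proj j b with hq
  have hqq : star (u * q) * (u * q) = q := by
    have h1 : star q = q := by
      rw [hq, star_mul, S.star_proj, S.star_proj, (S.commute i j a b).eq]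
    have h2 : q * q = q := by
      rw [hq, (S.commute i j a b).symm.mul_mul_mul_comm, S.proj_mul_self, S.proj_mul_self]
    rw [star_mul, mul_assoc, ← mul_assoc (star u), hm.star_mul_self, one_mul, h1, h2]
  have hT : ∀ L, Commute (u * q) (T.energy L) := fun L =>
    ChargeSystem.commute_energy (fun k c => (hm.commute k c).mul_left
      ((hcomm i k a c).mul_left (hcomm j k b c))) L
  have hmem : (u * q, -((n : ℂ) • (u * q))) ∈ derivLocal G := by
    refine ⟨mul_mem_localObs hu (mul_mem_localObs (hS i a) (hS j b)), ?_⟩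
    refine tendsto_const_nhds.congr' ?_
    filter_upwards [S.eventually_mem_region i, S.eventually_mem_region j] with L hi hj
    rw [← hen L hi hj, hham, add_mul, mul_add, (hT L).eq]
    abel
  have h1 := hω.2 _ (subset_closure hmem)
  simp only [mul_neg, mul_smul_comm, hqq, map_neg, map_smul, smul_eq_mul] at h1
  have h2 : 0 ≤ ω q := by
    have := hω.1.1 (u * q)
    rwa [hqq] at this
  have hn' : (0 : ℂ) < n := Nat.cast_pos.2 hn
  have h3 : (n : ℂ) * ω q = 0 :=
    le_antisymm (neg_nonneg.1 h1) (mul_nonneg hn'.le h2)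
  exact (mul_eq_zero.1 h3).resolve_left hn'.ne'

end Transport

theorem transports_electric (χ : Chars G) (v w : Vertex) :
    Transports (electricSystem G) (magneticSystem G) χ v w :=
  forall_of_neighbours (equivalence_transports _ _ χ)
    (fun x y => ⟨bondPhase ((x, y), false) χ, obs_mem_localObs _ _, moves_bondPhase _ χ⟩)
    (fun x y => ⟨bondPhase ((x, y), true) χ, obs_mem_localObs _ _, moves_bondPhase _ χ⟩) v w

theorem transports_magnetic (h : G) (f f' : Face) :
    Transports (magneticSystem G) (electricSystem G) h f f' := by
  refine forall_of_neighbours (equivalence_transports _ _ h) (fun x y => ?_) (fun x y => ?_) f f'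
  · refine ⟨bondShift ((x + 1, y), true) h, obs_mem_localObs _ _, moves_bondShift _ h fun f => ?_⟩
    rw [loop_mulSingle_up, add_sub_cancel_right]
  · refine ⟨bondShift ((x, y + 1), false) h⁻¹, obs_mem_localObs _ _,
      moves_bondShift _ _ fun f => ?_⟩
    rw [loop_mulSingle_right, add_sub_cancel_right, inv_inv]

/-- The ground states are the states with at most one electric and at most one magnetic charge. -/
theorem groundStates_eq : groundStates G = (chargePair G).ground := by
  ext ω
  constructor
  · intro h
    refine ⟨h.1.1, h.1.2, ?_, ?_⟩
    · exact atMostOne_of_groundState (S := electricSystem G) (T := magneticSystem G)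
        electric_commute_magnetic electric_mem_localObs ham_eq
        transports_electric h
    · exact atMostOne_of_groundState (S := magneticSystem G) (T := electricSystem G)
        (fun i j a b => (electric_commute_magnetic j i b a).symm)
        magnetic_mem_localObs (fun L => (ham_eq L).trans (add_comm _ _)) transports_magnetic h
  · rintro ⟨h1, h2, (h3 : (electricSystem G).AtMostOne ω), (h4 : (magneticSystem G).AtMostOne ω)⟩
    refine ⟨⟨h1, h2⟩, fun p hp => ?_⟩
    refine closure_minimal ?_ (isClosed_map_star_mul_nonneg ω) hp
    rintro ⟨x, y⟩ ⟨hx, hy⟩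
    refine ge_of_tendsto (tendsto_map_mul ω (star x) hy) ?_
    filter_upwards [electric_total_commute hx 1, magnetic_total_commute hx 1] with L he hm
    have h5 := add_nonneg (ChargeSystem.map_star_mul_commutator_energy_nonneg h1 h3 he)
      (ChargeSystem.map_star_mul_commutator_energy_nonneg h1 h4 hm)
    rw [← map_add, ← mul_add] at h5
    refine h5.trans_eq (congrArg ω (congrArg (fun z => star x * z) ?_))
    change _ = ham G L * x - x * ham G L
    rw [ham_eq, add_mul, mul_add]
    abel

/-- The conditional ground states of total charge `(χ, c)` form the sector `(χ, c)`. -/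
theorem chargedGroundStates_eq (χ : Chars G) (c : G) :
    chargedGroundStates χ c = (chargePair G).sector χ c := by
  ext φ
  rw [ChargePair.mem_sector_iff, ← groundStates_eq]
  simp only [chargePair_charge]
  rfl

theorem map_one_sub_proj_eq_zero_iff {A : Type*} [Fintype A] [CommGroup A]
    (S : ChargeSystem (quasiLocal G) A) {ω : WeakDual ℂ (quasiLocal G)} (hω : IsPositive ω)
    (i : ℤ × ℤ) : ω (1 - S.proj i 1) = 0 ↔ ∀ a, a ≠ 1 → ω (S.proj i a) = 0 := by
  classical
  rw [← S.sum_proj i, ← Finset.add_sum_erase _ _ (Finset.mem_univ 1), add_sub_cancel_left, map_sum,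
    Finset.sum_eq_zero_iff_of_nonneg fun a _ => ChargeSystem.map_proj_nonneg hω i a]
  simp

/-- The frustration-free ground states are the states without charges, which form the sector of
trivial total charge. -/
theorem frustrationFree_eq : frustrationFree G = (chargePair G).sector 1 1 := by
  ext ω
  rw [ChargePair.mem_sector_one_one_iff]
  change (ω ∈ groundStates G ∧ _) ↔ (ω ∈ (chargePair G).ground ∧ _)
  rw [groundStates_eq]
  refine and_congr_right fun h => and_congr (forall_congr' fun v => ?_) (forall_congr' fun f => ?_)
  · rw [← electric_one]
    refine (map_one_sub_proj_eq_zero_iff (electricSystem G) h.1 v).trans ?_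
    exact forall_congr' fun a => ⟨fun h1 h2 _ => h1 h2, fun h1 h2 => h1 h2 h2⟩
  · refine (map_one_sub_proj_eq_zero_iff (magneticSystem G) h.1 f).trans ?_
    exact forall_congr' fun a => ⟨fun h1 h2 _ => h1 h2, fun h1 h2 => h1 h2 h2⟩

end QuantumDouble

end KitaevQD

theorem mainTheorem4 (G : Type*) [CommGroup G] [Fintype G] [DecidableEq G]
    (χ : KitaevQD.Chars G) (c : G) :
    closure (KitaevQD.chargedGroundStates χ c) =
      convexHull ℝ (KitaevQD.frustrationFree G ∪ KitaevQD.chargedGroundStates χ 1 ∪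
        KitaevQD.chargedGroundStates 1 c ∪ KitaevQD.chargedGroundStates χ c) := by
  rw [KitaevQD.frustrationFree_eq, KitaevQD.chargedGroundStates_eq,
    KitaevQD.chargedGroundStates_eq, KitaevQD.chargedGroundStates_eq]
  exact (KitaevQD.chargePair G).closure_sector KitaevQD.mobile_chargePair
    KitaevQD.mobile_swap_chargePair χ c
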